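/- Let $\rho\in[0,1/2]$ and let $(X,Y)$ be the doubly symmetric binary source with crossover probability $\rho$: a pair on $\{0,1\}^2$ with pmf $q(x,y)=\frac{1-\rho}{2}$ if $x=y$ and $q(x,y)=\frac{\rho}{2}$ if $x\ne y$. Distortion is measured by the Hamming measure $\delta(a,b)=\mathbf 1[a\neq b]$. Write $h(\lambda)=-\lambda\log_2\lambda-(1-\lambda)\log_2(1-\lambda)$ (with $h(0)=h(1)=0$) and $$d^*=\tfrac12-\tfrac12\sqrt{1-2\rho}.$$ A rate-distortion (RD) code of length $n\geq 1$ with $m$ messages consists of an encoder $f:\{0,1\}^n\times\{0,1\}^n\to\{1,\dots,m\}$ and decoders $g_1,g_2:\{1,\dots,m\}\times\{0,1\}^n\to\{0,1\}^n$. For $(\mathbf X,\mathbf Y)=(X_1,Y_1),\dots,(X_n,Y_n)$ iid with pmf $q$ let $M=f(\mathbf X,\mathbf Y)$, $\hat{\mathbf X}=g_1(M,\mathbf Y)$, $\hat{\mathbf Y}=g_2(M,\mathbf X)$. Its rate is $\frac1n\log_2 m$ and its distortions are $\Delta_1=\mathbb E\big[\frac1n\sum_i\delta(X_i,\hat X_i)\big]$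 and $\Delta_2=\mathbb E\big[\frac1n\sum_i\delta(Y_i,\hat Y_i)\big]$. A common-reconstructions (CR) code has in addition maps $\phi_1,\phi_2:\{1,\dots,m\}\times\{0,1\}^n\to\{0,1\}^n$, and its error probability is $P_e=\max\{\Pr[\phi_2(M,\mathbf X)\ne\hat{\mathbf X}],\Pr[\phi_1(M,\mathbf Y)\neq\hat{\mathbf Y}]\}$. For $d_1,d_2\ge0$, $R(d_1,d_2)$ is the smallest $r\geq0$ such that for every $\epsilon>0$ there is an RD code of some length $n\ge1$ with rate at most $r+\epsilon$ and $\Delta_i\leq d_i+\epsilon$ for $i=1,2$; $R_{CR}(d_1,d_2)$ is the smallest $r\ge0$ such that for every $\epsilon>0$ there is a CR code of some length $n\ge 1$ that satisfies these bounds and $P_e\le\epsilon$. Let $R_X(d)$ be the minimum of $I(X;\hat X)$ over all channels $p_{\hat X|X}$ from $\{0,1\}$ to $\{0,1\}$ with $\mathbb E[\delta(X,\hat X)]\le d$, define $R_Y(d)$ likewise, and let Wyner's common information $K(X;Y)$ be the minimum of $I(X,Y;W)$ over all channels $p_{W|XY}$ into a set of at most $4$ elements for which $X - W - Y$ is a Markov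 chain (mutual information in bits). Then: (i) for all $d\in[0,d^*]$, $R_{CR}(d,d)=R(d,d)=h(\rho)-h(d)$; (ii) $R_{CR}(d^*,d^*)=K(X;Y)-R_X(d^*)=K(X;Y)-R_Y(d^*)$; (iii) for all $d\in(d^*,1/2]$, $R_{CR}(d,d)\ne h(\rho)-h(d)$ and $$R_{CR}(d,d)\le h(d)-\rho-(1-\rho)\,h\!\left(\frac{2d-\rho}{2(1-\rho)}\right).$$ -/

import Mathlib

noncomputable section

namespace TwoWayRelay

/-! ### Blockcodes, rates and the operational rate-distortion functions -/

/-- A rate-distortion blockcode of length `n` with `m` messages: receiver 1 knows `y` and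
reconstructs `x`, receiver 2 knows `x` and reconstructs `y`. -/
structure RDCode (X Y X' Y' : Type) (n m : ℕ) where
  enc : (Fin n → X) → (Fin n → Y) → Fin m
  dec₁ : Fin m → (Fin n → Y) → (Fin n → X')
  dec₂ : Fin m → (Fin n → X) → (Fin n → Y')

/-- A common-reconstructions code: in addition, receiver 1 reproduces the reconstruction made by
receiver 2, and vice versa. -/
structure CRCode (X Y X' Y' : Type) (n m : ℕ) extends RDCode X Y X' Y' n m where
  cr₁ : Fin m → (Fin n → Y) → (Fin n → Y')
  cr₂ : Fin m → (Fin n → X) → (Fin n → X')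

section Operational

variable {X Y X' Y' : Type} [Fintype X] [Fintype Y] [DecidableEq X'] [DecidableEq Y']

/-- Expectation of `F (𝐗, 𝐘)`, where `(X₁,Y₁), …, (Xₙ,Yₙ)` are iid with pmf `q`. -/
def blockExp (q : X × Y → ℝ) {n : ℕ} (F : (Fin n → X) → (Fin n → Y) → ℝ) : ℝ :=
  ∑ x : Fin n → X, ∑ y : Fin n → Y, (∏ i, q (x i, y i)) * F x y

/-- The rate `(1/n) log₂ m` of a code of length `n` with `m` messages. -/
def codeRate (n m : ℕ) : ℝ := Real.logb 2 m / n

namespace RDCode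

variable {n m : ℕ} (c : RDCode X Y X' Y' n m)

/-- The reconstruction of the `X`-sequence at receiver 1. -/
def hatX (x : Fin n → X) (y : Fin n → Y) : Fin n → X' := c.dec₁ (c.enc x y) y

/-- The reconstruction of the `Y`-sequence at receiver 2. -/
def hatY (x : Fin n → X) (y : Fin n → Y) : Fin n → Y' := c.dec₂ (c.enc x y) x

/-- Average distortion at receiver 1. -/
def dist₁ (q : X × Y → ℝ) (δ₁ : X → X' → ℝ) : ℝ :=
  blockExp q fun x y => (∑ i, δ₁ (x i) (c.hatX x y i)) / n

/-- Average distortion at receiver 2. -/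
def dist₂ (q : X × Y → ℝ) (δ₂ : Y → Y' → ℝ) : ℝ :=
  blockExp q fun x y => (∑ i, δ₂ (y i) (c.hatY x y i)) / n

end RDCode

namespace CRCode

variable {n m : ℕ} (c : CRCode X Y X' Y' n m)

/-- The copy of receiver 2's reconstruction that is produced at receiver 1. -/
def tildeY (x : Fin n → X) (y : Fin n → Y) : Fin n → Y' := c.cr₁ (c.enc x y) y

/-- The copy of receiver 1's reconstruction that is produced at receiver 2. -/
def tildeX (x : Fin n → X) (y : Fin n → Y) : Fin n → X' := c.cr₂ (c.enc x y) x

/-- The probability of common-reconstruction decoding error. -/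
def errProb (q : X × Y → ℝ) : ℝ :=
  max (blockExp q fun x y => if c.tildeX x y ≠ c.hatX x y then 1 else 0)
    (blockExp q fun x y => if c.tildeY x y ≠ c.hatY x y then 1 else 0)

end CRCode

/-- The set of `(d₁, d₂)`-achievable rates. -/
def rates (q : X × Y → ℝ) (δ₁ : X → X' → ℝ) (δ₂ : Y → Y' → ℝ) (d₁ d₂ : ℝ) : Set ℝ :=
  {r | 0 ≤ r ∧ ∀ ε : ℝ, 0 < ε → ∃ n m : ℕ, 0 < n ∧ ∃ c : RDCode X Y X' Y' n m,
    codeRate n m ≤ r + ε ∧ c.dist₁ q δ₁ ≤ d₁ + ε ∧ c.dist₂ q δ₂ ≤ d₂ + ε}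

/-- The set of rates that are `(d₁, d₂)`-achievable with common reconstructions. -/
def crRates (q : X × Y → ℝ) (δ₁ : X → X' → ℝ) (δ₂ : Y → Y' → ℝ) (d₁ d₂ : ℝ) : Set ℝ :=
  {r | 0 ≤ r ∧ ∀ ε : ℝ, 0 < ε → ∃ n m : ℕ, 0 < n ∧ ∃ c : CRCode X Y X' Y' n m,
    codeRate n m ≤ r + ε ∧ c.dist₁ q δ₁ ≤ d₁ + ε ∧ c.dist₂ q δ₂ ≤ d₂ + ε ∧ c.errProb q ≤ ε}

/-- The rate-distortion function `R(d₁, d₂)` (the infimum is a minimum: `isLeast_rdFun`). -/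
def rdFun (q : X × Y → ℝ) (δ₁ : X → X' → ℝ) (δ₂ : Y → Y' → ℝ) (d₁ d₂ : ℝ) : ℝ :=
  sInf (rates q δ₁ δ₂ d₁ d₂)

/-- The common-reconstructions rate-distortion function `R_CR(d₁, d₂)` (the infimum is a minimum:
`isLeast_crFun`). -/
def crFun (q : X × Y → ℝ) (δ₁ : X → X' → ℝ) (δ₂ : Y → Y' → ℝ) (d₁ d₂ : ℝ) : ℝ :=
  sInf (crRates q δ₁ δ₂ d₁ d₂)

end Operational

/-! ### Single-letter information quantities (in bits) -/

/-- The binary entropy function, in bits. -/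
def h (p : ℝ) : ℝ := Real.binEntropy p / Real.log 2

/-- The entropy of a pmf, in bits. -/
def entropy {α : Type} [Fintype α] (p : α → ℝ) : ℝ := (∑ a, Real.negMulLog (p a)) / Real.log 2

/-- First marginal. -/
def fstMarg {α β : Type} [Fintype β] (P : α × β → ℝ) (a : α) : ℝ := ∑ b, P (a, b)

/-- Second marginal. -/
def sndMarg {α β : Type} [Fintype α] (P : α × β → ℝ) (b : β) : ℝ := ∑ a, P (a, b)

/-- The mutual information `I(A;B) = H(A) + H(B) - H(A,B)` of a pair `(A, B)` with pmf `P`. -/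
def mutualInfo {α β : Type} [Fintype α] [Fintype β] (P : α × β → ℝ) : ℝ :=
  entropy (fstMarg P) + entropy (sndMarg P) - entropy P

/-- `p` is a channel (conditional pmf) from `α` to `β`; `p a b` is the probability of `b` given
`a`. -/
def IsChannel {α β : Type} [Fintype β] (p : α → β → ℝ) : Prop := ∀ a, p a ∈ stdSimplex ℝ β

/-- The joint pmf of input and output of the channel `p` with input pmf `q`. -/
def joint {α β : Type} (q : α → ℝ) (p : α → β → ℝ) (ab : α × β) : ℝ := q ab.1 * p ab.1 ab.2

/-- The values of `I(X; X̂)` over all test channels meeting the distortion constraint `d`. -/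
def rdValues {α β : Type} [Fintype α] [Fintype β] (q : α → ℝ) (δ : α → β → ℝ) (d : ℝ) : Set ℝ :=
  {r | ∃ p : α → β → ℝ, IsChannel p ∧ (∑ b, ∑ a, p a b * q a * δ a b) ≤ d ∧
    r = mutualInfo (joint q p)}

/-- The rate-distortion function of a single source with pmf `q` (the infimum is a minimum:
`isLeast_marginalRD`). -/
def marginalRD {α β : Type} [Fintype α] [Fintype β] (q : α → ℝ) (δ : α → β → ℝ) (d : ℝ) : ℝ :=
  sInf (rdValues q δ d)

/-- The Markov chain `X - W - Y` for `((X, Y), W)` with pmf `P`: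
`P(x,y,w) P(w) = P(x,w) P(y,w)`. -/
def IsMarkov {X Y W : Type} [Fintype X] [Fintype Y] (P : (X × Y) × W → ℝ) : Prop :=
  ∀ x y w, P ((x, y), w) * (∑ x', ∑ y', P ((x', y'), w)) =
    (∑ y', P ((x, y'), w)) * (∑ x', P ((x', y), w))

/-- The values of `I(X,Y;W)` over all auxiliary variables `W` with at most four values that make
`X - W - Y` a Markov chain. -/
def wynerValues (q : Fin 2 × Fin 2 → ℝ) : Set ℝ :=
  {r | ∃ k : ℕ, k ≤ 4 ∧ ∃ p : Fin 2 × Fin 2 → Fin k → ℝ, IsChannel p ∧ IsMarkov (joint q p) ∧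
    r = mutualInfo (joint q p)}

/-- Wyner's common information `K(X;Y)` of a pair of binary variables with pmf `q` (the infimum is
a minimum: `isLeast_wynerCI`). -/
def wynerCI (q : Fin 2 × Fin 2 → ℝ) : ℝ := sInf (wynerValues q)

/-! ### The doubly symmetric binary source -/

/-- The Hamming distortion measure. -/
def hamming {α : Type} [DecidableEq α] (a b : α) : ℝ := if a = b then 0 else 1

/-- The doubly symmetric binary source with crossover probability `ρ`: `X` is uniform and
`Y = X ⊕ Z` with `Z` independent of `X` and `P(Z = 1) = ρ`. -/
def dsbs (ρ : ℝ) (xy : Fin 2 × Fin 2) : ℝ := if xy.1 = xy.2 then (1 - ρ) / 2 else ρ / 2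

/-! ### Well-definedness: all the minima exist -/

theorem dsbs_mem_stdSimplex {ρ : ℝ} (hρ : ρ ∈ Set.Icc (0 : ℝ) (1 / 2)) :
    dsbs ρ ∈ stdSimplex ℝ (Fin 2 × Fin 2) := by
  obtain ⟨h0, h1⟩ := hρ
  refine ⟨fun xy => ?_, ?_⟩
  · unfold dsbs
    split_ifs <;> linarith
  · rw [Fintype.sum_prod_type]
    simp [dsbs, Fin.sum_univ_two]
    ring

section Least

variable {X Y X' Y' : Type} [Fintype X] [Fintype Y] [DecidableEq X'] [DecidableEq Y']

theorem crRates_nonempty (q : X × Y → ℝ) {δ₁ : X → X' → ℝ} {δ₂ : Y → Y' → ℝ}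
    (h₁ : ∀ x, ∃ x', δ₁ x x' = 0) (h₂ : ∀ y, ∃ y', δ₂ y y' = 0) {d₁ d₂ : ℝ}
    (hd₁ : 0 ≤ d₁) (hd₂ : 0 ≤ d₂) : (crRates q δ₁ δ₂ d₁ d₂).Nonempty := by
  choose a ha using h₁
  choose b hb using h₂
  let e : ((Fin 1 → X) × (Fin 1 → Y)) ≃ Fin (Fintype.card ((Fin 1 → X) × (Fin 1 → Y))) :=
    Fintype.equivFin _
  refine ⟨max 0 (codeRate 1 (Fintype.card ((Fin 1 → X) × (Fin 1 → Y)))), le_max_left _ _, ?_⟩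
  intro ε hε
  refine ⟨1, _, one_pos,
    { enc := fun x y => e (x, y)
      dec₁ := fun w _ i => a ((e.symm w).1 i)
      dec₂ := fun w _ i => b ((e.symm w).2 i)
      cr₁ := fun w _ i => b ((e.symm w).2 i)
      cr₂ := fun w _ i => a ((e.symm w).1 i) }, ?_, ?_, ?_, ?_⟩
  · exact (le_max_right _ _).trans (by linarith)
  · simp only [RDCode.dist₁, RDCode.hatX, blockExp, Equiv.symm_apply_apply, ha]
    simp
    linarith
  · simp only [RDCode.dist₂, RDCode.hatY, blockExp, Equiv.symm_apply_apply, hb]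
    simp
    linarith
  · simp [CRCode.errProb, CRCode.tildeX, CRCode.tildeY, RDCode.hatX, RDCode.hatY, blockExp, hε.le]

theorem crRates_subset_rates (q : X × Y → ℝ) (δ₁ : X → X' → ℝ) (δ₂ : Y → Y' → ℝ) (d₁ d₂ : ℝ) :
    crRates q δ₁ δ₂ d₁ d₂ ⊆ rates q δ₁ δ₂ d₁ d₂ := by
  rintro r ⟨hr, H⟩
  refine ⟨hr, fun ε hε => ?_⟩
  obtain ⟨n, m, hn, c, hc⟩ := H ε hε
  exact ⟨n, m, hn, c.toRDCode, hc.1, hc.2.1, hc.2.2.1⟩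

theorem isLeast_crFun (q : X × Y → ℝ) {δ₁ : X → X' → ℝ} {δ₂ : Y → Y' → ℝ}
    (h₁ : ∀ x, ∃ x', δ₁ x x' = 0) (h₂ : ∀ y, ∃ y', δ₂ y y' = 0) {d₁ d₂ : ℝ}
    (hd₁ : 0 ≤ d₁) (hd₂ : 0 ≤ d₂) :
    IsLeast (crRates q δ₁ δ₂ d₁ d₂) (crFun q δ₁ δ₂ d₁ d₂) := by
  have hne := crRates_nonempty q h₁ h₂ hd₁ hd₂
  have hb : BddBelow (crRates q δ₁ δ₂ d₁ d₂) := ⟨0, fun r hr => hr.1⟩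
  refine ⟨⟨le_csInf hne fun r hr => hr.1, fun ε hε => ?_⟩, fun r hr => csInf_le hb hr⟩
  obtain ⟨r, hr, hlt⟩ := exists_lt_of_csInf_lt hne
    (show sInf (crRates q δ₁ δ₂ d₁ d₂) < crFun q δ₁ δ₂ d₁ d₂ + ε / 2 by
      unfold crFun; linarith)
  obtain ⟨n, m, hn, c, hc⟩ := hr.2 (ε / 2) (by linarith)
  exact ⟨n, m, hn, c, by linarith [hc.1], by linarith [hc.2.1], by linarith [hc.2.2.1],
    by linarith [hc.2.2.2]⟩

theorem isLeast_rdFun (q : X × Y → ℝ) {δ₁ : X → X' → ℝ} {δ₂ : Y → Y' → ℝ}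
    (h₁ : ∀ x, ∃ x', δ₁ x x' = 0) (h₂ : ∀ y, ∃ y', δ₂ y y' = 0) {d₁ d₂ : ℝ}
    (hd₁ : 0 ≤ d₁) (hd₂ : 0 ≤ d₂) :
    IsLeast (rates q δ₁ δ₂ d₁ d₂) (rdFun q δ₁ δ₂ d₁ d₂) := by
  have hne : (rates q δ₁ δ₂ d₁ d₂).Nonempty :=
    (crRates_nonempty q h₁ h₂ hd₁ hd₂).mono (crRates_subset_rates q δ₁ δ₂ d₁ d₂)
  have hb : BddBelow (rates q δ₁ δ₂ d₁ d₂) := ⟨0, fun r hr => hr.1⟩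
  refine ⟨⟨le_csInf hne fun r hr => hr.1, fun ε hε => ?_⟩, fun r hr => csInf_le hb hr⟩
  obtain ⟨r, hr, hlt⟩ := exists_lt_of_csInf_lt hne
    (show sInf (rates q δ₁ δ₂ d₁ d₂) < rdFun q δ₁ δ₂ d₁ d₂ + ε / 2 by
      unfold rdFun; linarith)
  obtain ⟨n, m, hn, c, hc⟩ := hr.2 (ε / 2) (by linarith)
  exact ⟨n, m, hn, c, by linarith [hc.1], by linarith [hc.2.1], by linarith [hc.2.2]⟩

end Least

theorem isCompact_isChannel (α β : Type) [Fintype β] :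
    IsCompact {p : α → β → ℝ | IsChannel p} := by
  have : {p : α → β → ℝ | IsChannel p} = Set.pi Set.univ fun _ => stdSimplex ℝ β := by
    ext p
    simp [IsChannel]
  rw [this]
  exact isCompact_univ_pi fun _ => isCompact_stdSimplex ℝ β

theorem continuous_mutualInfo_joint {α β : Type} [Fintype α] [Fintype β] (q : α → ℝ) :
    Continuous fun p : α → β → ℝ => mutualInfo (joint q p) := by
  unfold mutualInfo entropy fstMarg sndMarg joint
  fun_prop

theorem isLeast_marginalRD {α β : Type} [Fintype α] [Fintype β] (q : α → ℝ) {δ : α → β → ℝ}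
    (hδ : ∀ a, ∃ b, δ a b = 0) {d : ℝ} (hd : 0 ≤ d) :
    IsLeast (rdValues q δ d) (marginalRD q δ d) := by
  classical
  have himg : rdValues q δ d = (fun p : α → β → ℝ => mutualInfo (joint q p)) ''
      ({p | IsChannel p} ∩ {p | (∑ b, ∑ a, p a b * q a * δ a b) ≤ d}) := by
    ext r
    simp only [rdValues, Set.mem_ofPred_eq, Set.mem_image, Set.mem_inter_iff, and_assoc]
    exact ⟨fun ⟨p, h1, h2, h3⟩ => ⟨p, h1, h2, h3.symm⟩, fun ⟨p, h1, h2, h3⟩ => ⟨p, h1, h2, h3.symm⟩⟩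
  have hcpt : IsCompact (rdValues q δ d) := by
    rw [himg]
    exact ((isCompact_isChannel α β).inter_right
      (isClosed_le (by fun_prop) continuous_const)).image (continuous_mutualInfo_joint q)
  have hne : (rdValues q δ d).Nonempty := by
    choose f hf using hδ
    refine ⟨_, fun a b => if f a = b then 1 else 0, fun a => ⟨fun b => ?_, ?_⟩, ?_, rfl⟩
    · dsimp only
      split_ifs <;> norm_num
    · simp
    · rw [Finset.sum_comm]
      simpa [hf] using hd
  exact hcpt.isLeast_sInf hne

theorem isLeast_wynerCI (q : Fin 2 × Fin 2 → ℝ) : IsLeast (wynerValues q) (wynerCI q) := by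
  have himg : wynerValues q = ⋃ k ∈ Set.Iic 4,
      (fun p : Fin 2 × Fin 2 → Fin k → ℝ => mutualInfo (joint q p)) ''
        ({p | IsChannel p} ∩ {p | IsMarkov (joint q p)}) := by
    ext r
    simp only [wynerValues, Set.mem_ofPred_eq, Set.mem_iUnion, Set.mem_Iic, exists_prop,
      Set.mem_image, Set.mem_inter_iff, and_assoc]
    exact ⟨fun ⟨k, hk, p, h1, h2, h3⟩ => ⟨k, hk, p, h1, h2, h3.symm⟩,
      fun ⟨k, hk, p, h1, h2, h3⟩ => ⟨k, hk, p, h1, h2, h3.symm⟩⟩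
  have hcpt : IsCompact (wynerValues q) := by
    rw [himg]
    refine (Set.finite_Iic 4).isCompact_biUnion fun k _ => ?_
    refine ((isCompact_isChannel _ _).inter_right ?_).image (continuous_mutualInfo_joint q)
    simp only [IsMarkov, Set.ofPred_forall]
    refine isClosed_iInter fun x => isClosed_iInter fun y => isClosed_iInter fun w => ?_
    unfold joint
    exact isClosed_eq (by fun_prop) (by fun_prop)
  have hne : (wynerValues q).Nonempty := by
    let e : Fin 2 × Fin 2 ≃ Fin 4 := finProdFinEquiv
    refine ⟨_, 4, le_rfl, fun xy w => if e xy = w then 1 else 0,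
      fun a => ⟨fun b => ?_, ?_⟩, ?_, rfl⟩
    · dsimp only
      split_ifs <;> norm_num
    · simp
    · intro x y w
      obtain ⟨⟨a, b⟩, rfl⟩ := e.surjective w
      simp only [joint, e.injective.eq_iff, Prod.mk.injEq]
      fin_cases x <;> fin_cases y <;> fin_cases a <;> fin_cases b <;>
        simp [Fin.sum_univ_two]
  exact hcpt.isLeast_sInf hne

end TwoWayRelay

end

noncomputable section

namespace TwoWayRelay

open Finset

/-! ### Sums over product pmfs -/

/-! On `[0, 1/2]` the condition `d ≤ d*` is the same as `2d(1-d) ≤ ρ`, because `2d*(1-d*) = ρ`: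
feeding a common bit through two independent binary symmetric channels with crossover `d*` produces
exactly the source.

Achievability rests on one random coding theorem, `mem_crRates_of_joint`. For any auxiliary `W` it
achieves the larger of `I(X,Y;W) - I(X;W)` and `I(X,Y;W) - I(Y;W)`; both receivers recover the same
`W`-codeword, so reconstructions that are functions of `W` are automatically common. Below `d*` one
takes `W = (U,V)`, itself a doubly symmetric source, with `X = U ⊕ N₁` and `Y = V ⊕ N₂`; the rate is
`(1 + h(ρ) - 2h(d)) - (1 - h(d))`. The bound above `d*` comes from a single bit `W`.

The converse `binEntropy_sub_condEnt_le` bounds the rate below by `H(X|Y) - H(X|A,Y)` for the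
averaged letter law, and `condEnt_le` (Fano through Jensen) bounds `H(X|A,Y)` by the binary entropy
of the distortion. This gives `h(ρ) - h(d)` for every code.

Above `d*` this bound is not attained with common reconstructions. Take codes whose rates tend to
`h(ρ) - h(d)`. Because the pair of reconstructions is known at both receivers up to vanishing error,
a limit letter law satisfies both converses with equality for the same `W = (X̂, Ŷ)`. Strict
concavity then forces `X` and `Y` to be `X̂` and `Ŷ` corrupted by independent noises of level `d`,
so `ρ = P(X ≠ Y) ≥ 2d(1-d)`, that is, `d ≤ d*`.

For (ii), `K(X;Y) = 1 + h(ρ) - 2h(d*)` and `R_X(d*) = R_Y(d*) = 1 - h(d*)`, so the difference is the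
value already found at `d*`. The formula for `K` rests on concavity of the binary entropy as a
function of the squared distance to `1/2`. -/

theorem sum_prod_pi {ι Z : Type} [Fintype ι] [DecidableEq ι] [Fintype Z] (f : ι → Z → ℝ) :
    ∑ z : ι → Z, ∏ i, f i (z i) = ∏ i, ∑ z, f i z := by
  rw [Finset.prod_univ_sum, Fintype.piFinset_univ]

theorem sum_prod_pi_const {Z : Type} [Fintype Z] (n : ℕ) (P : Z → ℝ) :
    ∑ z : Fin n → Z, ∏ i, P (z i) = (∑ z, P z) ^ n := by
  rw [sum_prod_pi fun _ => P]
  simp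

theorem sum_fin_succ_pi {Z : Type} [Fintype Z] {n : ℕ} (F : (Fin (n + 1) → Z) → ℝ) :
    ∑ z, F z = ∑ z₀, ∑ z : Fin n → Z, F (Fin.cons z₀ z) := by
  rw [← (Fin.consEquiv fun _ => Z).sum_comp, Fintype.sum_prod_type]
  rfl

/-- The mean of a sum of functions of the letters of an iid sequence. -/
theorem sum_prod_mul_sum {Z : Type} [Fintype Z] {P : Z → ℝ} (hP : ∑ z, P z = 1) (n : ℕ)
    (g : Z → ℝ) :
    ∑ z : Fin n → Z, (∏ i, P (z i)) * ∑ i, g (z i) = n * ∑ z, P z * g z := by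
  induction n with
  | zero => simp
  | succ n ih =>
    rw [sum_fin_succ_pi]
    simp only [Fin.prod_univ_succ, Fin.sum_univ_succ, Fin.cons_zero, Fin.cons_succ]
    have : ∀ z₀ : Z, ∑ z : Fin n → Z, P z₀ * (∏ i, P (z i)) * (g z₀ + ∑ i, g (z i)) =
        P z₀ * g z₀ + P z₀ * (n * ∑ z, P z * g z) := by
      intro z₀
      rw [← ih, ← mul_one (P z₀ * g z₀), ← one_pow n, ← hP, ← sum_prod_pi_const, mul_sum, mul_sum,
        ← sum_add_distrib]
      exact sum_congr rfl fun z _ => by ring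
    simp only [this, sum_add_distrib]
    rw [← sum_mul, hP]
    push_cast
    ring

/-- The second moment of a sum of centred functions of the letters of an iid sequence. -/
theorem sum_prod_mul_sum_sq {Z : Type} [Fintype Z] {P : Z → ℝ} (hP : ∑ z, P z = 1) (n : ℕ)
    {g : Z → ℝ} (hg : ∑ z, P z * g z = 0) :
    ∑ z : Fin n → Z, (∏ i, P (z i)) * (∑ i, g (z i)) ^ 2 = n * ∑ z, P z * g z ^ 2 := by
  induction n with
  | zero => simp
  | succ n ih =>
    rw [sum_fin_succ_pi]
    simp only [Fin.prod_univ_succ, Fin.sum_univ_succ, Fin.cons_zero, Fin.cons_succ]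
    have : ∀ z₀ : Z, ∑ z : Fin n → Z, P z₀ * (∏ i, P (z i)) * (g z₀ + ∑ i, g (z i)) ^ 2 =
        P z₀ * g z₀ ^ 2 + P z₀ * (n * ∑ z, P z * g z ^ 2) := by
      intro z₀
      have h1 : ∑ z : Fin n → Z, (∏ i, P (z i)) = 1 := by rw [sum_prod_pi_const, hP, one_pow]
      have h2 : ∑ z : Fin n → Z, (∏ i, P (z i)) * ∑ i, g (z i) = 0 := by
        rw [sum_prod_mul_sum hP, hg, mul_zero]
      calc _ = P z₀ * g z₀ ^ 2 * ∑ z : Fin n → Z, (∏ i, P (z i)) +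
            2 * P z₀ * g z₀ * (∑ z : Fin n → Z, (∏ i, P (z i)) * ∑ i, g (z i)) +
            P z₀ * ∑ z : Fin n → Z, (∏ i, P (z i)) * (∑ i, g (z i)) ^ 2 := by
              simp only [mul_sum (s := (univ : Finset (Fin n → Z)))]
              rw [← sum_add_distrib, ← sum_add_distrib]
              exact sum_congr rfl fun z _ => by ring
        _ = _ := by rw [h1, h2, ih]; ring
    simp only [this, sum_add_distrib]
    rw [← sum_mul, hP]
    push_cast
    ring

open Classical in
/-- The one-sided weak law of large numbers over a finite alphabet. -/
theorem eventually_prob_sum_gt_le {Z : Type} [Fintype Z] {P : Z → ℝ} (h0 : ∀ z, 0 ≤ P z)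
    (hP : ∑ z, P z = 1) (f : Z → ℝ) {μ δ η : ℝ} (hμ : ∑ z, P z * f z ≤ μ) (hδ : 0 < δ)
    (hη : 0 < η) :
    ∀ᶠ n : ℕ in Filter.atTop, ∑ z : Fin n → Z, (∏ i, P (z i)) *
      (if n * (μ + δ) < ∑ i, f (z i) then 1 else 0) ≤ η := by
  set μ' := ∑ z, P z * f z with hμ'
  set g : Z → ℝ := fun z => f z - μ' with hg
  have hg0 : ∑ z, P z * g z = 0 := by
    simp only [hg, mul_sub, sum_sub_distrib, ← sum_mul, hP]
    simp [hμ']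
  set V := ∑ z, P z * g z ^ 2 with hV
  filter_upwards [Filter.eventually_gt_atTop 0,
    tendsto_natCast_atTop_atTop.eventually_ge_atTop (V / (δ ^ 2 * η))] with n hn hnV
  have hn' : (0 : ℝ) < n := by exact_mod_cast hn
  have key : ∀ z : Fin n → Z, (∏ i, P (z i)) * (if n * (μ + δ) < ∑ i, f (z i) then 1 else 0) ≤
      ((∏ i, P (z i)) * (∑ i, g (z i)) ^ 2) / (n * δ) ^ 2 := by
    intro z
    rw [mul_div_assoc]
    refine mul_le_mul_of_nonneg_left ?_ (prod_nonneg fun i _ => h0 _)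
    split_ifs with h
    · rw [le_div_iff₀ (by positivity), one_mul]
      have : ∑ i, g (z i) = ∑ i, f (z i) - n * μ' := by simp [hg, sum_sub_distrib]
      have : n * δ ≤ ∑ i, g (z i) := by nlinarith
      gcongr
    · positivity
  refine (sum_le_sum fun z _ => key z).trans ?_
  rw [← sum_div, sum_prod_mul_sum_sq hP n hg0, ← hV]
  rw [div_le_iff₀ (by positivity)] at hnV ⊢
  nlinarith [mul_le_mul_of_nonneg_left hnV hn'.le]

/-! ### A one-shot random coding bound -/

theorem exists_le_of_weighted_sum_le {C : Type} [Fintype C] {w f : C → ℝ} (h0 : ∀ c, 0 ≤ w c)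
    (h1 : ∑ c, w c = 1) {B : ℝ} (hB : ∑ c, w c * f c ≤ B) : ∃ c, f c ≤ B := by
  by_contra! h
  have hpos : ∃ c, 0 < w c := by
    by_contra! h'
    have : ∑ c, w c ≤ 0 := sum_nonpos fun c _ => h' c
    linarith
  obtain ⟨c, hc⟩ := hpos
  have : ∑ c, w c * B < ∑ c, w c * f c :=
    sum_lt_sum (fun c _ => mul_le_mul_of_nonneg_left (h c).le (h0 c))
      ⟨c, mem_univ _, mul_lt_mul_of_pos_left (h c) hc⟩
  rw [← sum_mul, h1, one_mul] at this
  linarith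

/-- Under a uniformly random map into `m` bins, distinct points collide with probability `1/m`. -/
theorem sum_collision {N m : ℕ} {i k : Fin N} (hik : i ≠ k) :
    (m : ℝ) * ∑ b : Fin N → Fin m, (if b i = b k then (1 : ℝ) else 0) = (m : ℝ) ^ N := by
  have h1 : ∑ b : Fin N → Fin m, (if b i = b k then (1 : ℝ) else 0) =
      ∑ r : {j // j ≠ k} → Fin m, (1 : ℝ) := by
    rw [← (Equiv.funSplitAt k (Fin m)).symm.sum_comp, Fintype.sum_prod_type, sum_comm]
    refine sum_congr rfl fun r _ => ?_
    simp [Equiv.funSplitAt, Equiv.piSplitAt, hik]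
  have h2 : Fintype.card (Fin N → Fin m) = Fintype.card (Fin m × ({j // j ≠ k} → Fin m)) :=
    Fintype.card_congr (Equiv.funSplitAt k (Fin m))
  rw [h1]
  rw [Fintype.card_prod, Fintype.card_fun, Fintype.card_fin, Fintype.card_fin] at h2
  simp only [sum_const, card_univ, nsmul_eq_mul, mul_one]
  exact_mod_cast h2.symm

/-- Covering estimate: `g` is the chance that a fresh codeword is compatible with the source, `a`
the same chance under the true joint law, `κ` a bound on the density ratio. After `(1-g)^N ≤
exp(-aN/κ)`, convexity of `exp` between `0` and `-N/κ` separates the two error terms. -/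
theorem one_sub_pow_le {g a κ : ℝ} (hκ : 0 < κ) (hg : g ≤ 1) (ha0 : 0 ≤ a) (ha1 : a ≤ 1)
    (hag : a ≤ κ * g) (N : ℕ) : (1 - g) ^ N ≤ 1 - a + Real.exp (-(N / κ)) := by
  have h1 : (1 - g) ^ N ≤ Real.exp (-g) ^ N :=
    pow_le_pow_left₀ (by linarith) (by linarith [Real.add_one_le_exp (-g)]) N
  have h2 : Real.exp (-g) ^ N ≤ Real.exp (a * (-(N / κ))) := by
    rw [← Real.exp_nat_mul, Real.exp_le_exp]
    have : a / κ ≤ g := by rw [div_le_iff₀ hκ]; linarith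
    have := mul_le_mul_of_nonneg_left this (Nat.cast_nonneg (α := ℝ) N)
    calc (N : ℝ) * -g ≤ -(N * (a / κ)) := by linarith
      _ = _ := by ring
  have h3 := convexOn_exp.2 (Set.mem_univ (0 : ℝ)) (Set.mem_univ (-(N / κ))) (sub_nonneg.2 ha1)
    ha0 (sub_add_cancel 1 a)
  simp only [smul_eq_mul, mul_zero, zero_add, Real.exp_zero, mul_one] at h3
  have h4 : a * Real.exp (-(N / κ)) ≤ Real.exp (-(N / κ)) :=
    mul_le_of_le_one_left (Real.exp_nonneg _) ha1
  linarith

open Classical in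
/-- One-shot coding with a random codebook, random binning and an encoder that picks a codeword
compatible with the source pair. Outside an event of small probability, both receivers recover that
codeword. -/
theorem exists_binning_code {𝒳 𝒴 𝒲 : Type} [Fintype 𝒳] [Fintype 𝒴] [Fintype 𝒲] {q : 𝒳 → 𝒴 → ℝ}
    {J : 𝒳 → 𝒴 → 𝒲 → ℝ} {pW : 𝒲 → ℝ} (hJ : ∀ x y w, 0 ≤ J x y w)
    (hq : ∀ x y, ∑ w, J x y w = q x y) (hq1 : ∑ x, ∑ y, q x y = 1) (hpW : ∀ w, 0 ≤ pW w)
    (hpW1 : ∑ w, pW w = 1) {G : 𝒳 → 𝒴 → 𝒲 → Prop} {TX : 𝒳 → 𝒲 → Prop} {TY : 𝒴 → 𝒲 → Prop}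
    (hGX : ∀ x y w, G x y w → TX x w) (hGY : ∀ x y w, G x y w → TY y w) {κ : ℝ} (hκ : 0 < κ)
    (hG : ∀ x y w, G x y w → J x y w ≤ κ * (q x y * pW w)) {τ : ℝ}
    (hX : ∀ x, ∑ w, pW w * (if TX x w then 1 else 0) ≤ τ)
    (hY : ∀ y, ∑ w, pW w * (if TY y w then 1 else 0) ≤ τ) {N m : ℕ} (hN : 0 < N) (hm : 0 < m) :
    ∃ (enc : 𝒳 → 𝒴 → Fin m) (D₁ : Fin m → 𝒴 → 𝒲) (D₂ : Fin m → 𝒳 → 𝒲),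
      ∑ x, ∑ y, q x y * (if G x y (D₁ (enc x y) y) ∧ D₂ (enc x y) x = D₁ (enc x y) y then 0 else 1)
        ≤ (∑ x, ∑ y, ∑ w, J x y w * (if G x y w then 0 else 1)) + Real.exp (-(N / κ)) +
          2 * (N / m * τ) := by
  have hq0 : ∀ x y, 0 ≤ q x y := fun x y => by rw [← hq]; exact sum_nonneg fun w _ => hJ x y w
  have hm' : (0 : ℝ) < m := by exact_mod_cast hm
  have hι : ∀ (c : Fin N → 𝒲) (x : 𝒳) (y : 𝒴), ∃ k : Fin N, (∃ i, G x y (c i)) → G x y (c k) := by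
    intro c x y
    by_cases h : ∃ i, G x y (c i)
    · exact ⟨h.choose, fun _ => h.choose_spec⟩
    · exact ⟨⟨0, hN⟩, fun h' => absurd h' h⟩
  -- Each decoder sees only the bin index and its own source block, and picks some codeword of that
  -- bin passing its test.
  have hkY : ∀ (c : Fin N → 𝒲) (b : Fin N → Fin m) (j : Fin m) (y : 𝒴), ∃ k : Fin N,
      (∃ i, b i = j ∧ TY y (c i)) → b k = j ∧ TY y (c k) := by
    intro c b j y
    by_cases h : ∃ i, b i = j ∧ TY y (c i)
    · exact ⟨h.choose, fun _ => h.choose_spec⟩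
    · exact ⟨⟨0, hN⟩, fun h' => absurd h' h⟩
  have hkX : ∀ (c : Fin N → 𝒲) (b : Fin N → Fin m) (j : Fin m) (x : 𝒳), ∃ k : Fin N,
      (∃ i, b i = j ∧ TX x (c i)) → b k = j ∧ TX x (c k) := by
    intro c b j x
    by_cases h : ∃ i, b i = j ∧ TX x (c i)
    · exact ⟨h.choose, fun _ => h.choose_spec⟩
    · exact ⟨⟨0, hN⟩, fun h' => absurd h' h⟩
  choose ι hι using hι
  choose kY hkY using hkY
  choose kX hkX using hkX
  set T : 𝒳 → 𝒴 → 𝒲 → ℝ := fun x y w => (if TY y w then 1 else 0) + (if TX x w then 1 else 0)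
    with hT
  have hT0 : ∀ x y w, 0 ≤ T x y w := fun x y w => by
    simp only [hT]; split_ifs <;> norm_num
  set A : (Fin N → 𝒲) → 𝒳 → 𝒴 → ℝ := fun c x y => ∏ i, (if G x y (c i) then 0 else 1) with hA
  have hA0 : ∀ c x y, 0 ≤ A c x y := fun c x y =>
    prod_nonneg fun i _ => by split_ifs <;> norm_num
  set col : (Fin N → Fin m) → Fin N → Fin N → ℝ := fun b i k =>
    if i = k then 0 else if b i = b k then 1 else 0 with hcol
  have hcol0 : ∀ b i k, 0 ≤ col b i k := fun b i k => by
    simp only [hcol]; split_ifs <;> norm_num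
  set bad : (Fin N → 𝒲) → (Fin N → Fin m) → 𝒳 → 𝒴 → ℝ := fun c b x y =>
    if G x y (c (kY c b (b (ι c x y)) y)) ∧
      c (kX c b (b (ι c x y)) x) = c (kY c b (b (ι c x y)) y) then 0 else 1 with hbad
  -- Union bound: a failure needs either no compatible codeword, or a codeword other than the
  -- encoder's choice that shares its bin and passes one of the two tests.
  have hbad_le : ∀ c b x y, bad c b x y ≤ A c x y + ∑ i, col b i (ι c x y) * T x y (c i) := by
    intro c b x y
    have hs0 : ∀ i ∈ (univ : Finset (Fin N)), 0 ≤ col b i (ι c x y) * T x y (c i) :=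
      fun i _ => mul_nonneg (hcol0 _ _ _) (hT0 _ _ _)
    by_cases hf : ∃ i, G x y (c i)
    · have hgι := hι c x y hf
      have hY' := hkY c b (b (ι c x y)) y ⟨_, rfl, hGY _ _ _ hgι⟩
      have hX' := hkX c b (b (ι c x y)) x ⟨_, rfl, hGX _ _ _ hgι⟩
      by_cases h1 : kY c b (b (ι c x y)) y = ι c x y
      · by_cases h2 : kX c b (b (ι c x y)) x = ι c x y
        · have : bad c b x y = 0 := by
            simp only [hbad]
            rw [if_pos]
            rw [h1, h2]
            exact ⟨hgι, rfl⟩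
          rw [this]
          exact add_nonneg (hA0 _ _ _) (sum_nonneg hs0)
        · have h3 := single_le_sum hs0 (mem_univ (kX c b (b (ι c x y)) x))
          have h4 : 1 ≤ col b (kX c b (b (ι c x y)) x) (ι c x y) *
              T x y (c (kX c b (b (ι c x y)) x)) := by
            simp only [hcol, hT, if_neg h2, if_pos hX'.1, if_pos hX'.2]
            split_ifs <;> norm_num
          have h5 : bad c b x y ≤ 1 := by simp only [hbad]; split_ifs <;> norm_num
          linarith [hA0 c x y]
      · have h3 := single_le_sum hs0 (mem_univ (kY c b (b (ι c x y)) y))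
        have h4 : 1 ≤ col b (kY c b (b (ι c x y)) y) (ι c x y) *
            T x y (c (kY c b (b (ι c x y)) y)) := by
          simp only [hcol, hT, if_neg h1, if_pos hY'.1, if_pos hY'.2]
          split_ifs <;> norm_num
        have h5 : bad c b x y ≤ 1 := by simp only [hbad]; split_ifs <;> norm_num
        linarith [hA0 c x y]
    · have : A c x y = 1 := by
        push Not at hf
        simp [hA, hf]
      rw [this]
      have h5 : bad c b x y ≤ 1 := by simp only [hbad]; split_ifs <;> norm_num
      linarith [sum_nonneg hs0]
  have hcol_sum : ∀ i k, ∑ b, col b i k ≤ (m : ℝ) ^ N * (1 / m) := by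
    intro i k
    by_cases h : i = k
    · simp only [hcol, if_pos h, sum_const_zero]
      positivity
    · simp only [hcol, if_neg h]
      rw [← sum_collision h]
      field_simp
      exact le_rfl
  -- Error bound for a fixed codebook after averaging over the binning: the encoder's index does not
  -- depend on the bins, so each collision contributes at most `1/m`.
  set Ψ : (Fin N → 𝒲) → ℝ := fun c => ∑ x, ∑ y, q x y * (A c x y + 1 / m * ∑ i, T x y (c i))
    with hΨ
  have hb : ∀ c, ∑ b, ∑ x, ∑ y, q x y * bad c b x y ≤ ∑ b : Fin N → Fin m, Ψ c := by
    intro c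
    rw [sum_comm]
    simp only [hΨ]
    rw [sum_comm (s := (univ : Finset (Fin N → Fin m)))]
    refine sum_le_sum fun x _ => ?_
    rw [sum_comm, sum_comm (s := (univ : Finset (Fin N → Fin m)))]
    refine sum_le_sum fun y _ => ?_
    rw [← mul_sum, ← mul_sum]
    refine mul_le_mul_of_nonneg_left ?_ (hq0 x y)
    refine (sum_le_sum fun b _ => hbad_le c b x y).trans ?_
    rw [sum_add_distrib, sum_add_distrib]
    refine add_le_add_right ?_ _
    rw [sum_comm]
    simp only [← sum_mul]
    simp only [sum_const, card_univ, Fintype.card_fun, Fintype.card_fin, nsmul_eq_mul,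
      Nat.cast_pow]
    rw [mul_sum]
    exact sum_le_sum fun i _ => mul_le_mul_of_nonneg_right (hcol_sum _ _) (hT0 _ _ _)
  have hA_sum : ∀ x y, q x y * ∑ c : Fin N → 𝒲, (∏ i, pW (c i)) * A c x y ≤
      (∑ w, J x y w * (if G x y w then 0 else 1)) + q x y * Real.exp (-(N / κ)) := by
    intro x y
    rcases (hq0 x y).eq_or_lt with h | h
    · rw [← h, zero_mul, zero_mul, add_zero]
      exact sum_nonneg fun w _ => mul_nonneg (hJ _ _ _) (by split_ifs <;> norm_num)
    · set g := ∑ w, pW w * (if G x y w then 1 else 0) with hg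
      have e1 : ∑ c : Fin N → 𝒲, (∏ i, pW (c i)) * A c x y = (1 - g) ^ N := by
        simp only [hA, ← prod_mul_distrib]
        rw [sum_prod_pi_const N fun w => pW w * (if G x y w then 0 else 1)]
        congr 1
        rw [hg, eq_sub_iff_add_eq, ← sum_add_distrib]
        refine Eq.trans ?_ hpW1
        exact sum_congr rfl fun w _ => by split_ifs <;> simp
      set a := (∑ w, J x y w * (if G x y w then 1 else 0)) / q x y with ha
      have e2 : ∑ w, J x y w * (if G x y w then 0 else 1) = q x y * (1 - a) := by
        rw [ha, mul_sub, mul_one, mul_div_cancel₀ _ h.ne']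
        rw [eq_sub_iff_add_eq, ← sum_add_distrib, ← hq]
        exact sum_congr rfl fun w _ => by split_ifs <;> simp
      rw [e1, e2, ← mul_add]
      refine mul_le_mul_of_nonneg_left ?_ h.le
      refine one_sub_pow_le hκ ?_ ?_ ?_ ?_ N
      · refine le_of_le_of_eq ?_ hpW1
        refine sum_le_sum fun w _ => ?_
        have := hpW w
        split_ifs <;> linarith
      · exact div_nonneg (sum_nonneg fun w _ => mul_nonneg (hJ _ _ _) (by split_ifs <;> norm_num))
          h.le
      · rw [ha, div_le_one h]
        rw [← hq]
        refine sum_le_sum fun w _ => ?_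
        have := hJ x y w
        split_ifs <;> linarith
      · rw [ha, div_le_iff₀ h, hg, mul_sum, sum_mul]
        refine sum_le_sum fun w _ => ?_
        split_ifs with hgw
        · have := hG x y w hgw
          linarith
        · simp
  have hΨ_sum : ∑ c : Fin N → 𝒲, (∏ i, pW (c i)) * Ψ c ≤
      (∑ x, ∑ y, ∑ w, J x y w * (if G x y w then 0 else 1)) + Real.exp (-(N / κ)) +
          2 * (N / m * τ) := by
    have e : ∑ c : Fin N → 𝒲, (∏ i, pW (c i)) * Ψ c = ∑ x, ∑ y,
        (q x y * (∑ c : Fin N → 𝒲, (∏ i, pW (c i)) * A c x y) +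
          q x y * (1 / m * (N * ∑ w, pW w * T x y w))) := by
      simp only [hΨ, mul_sum (s := (univ : Finset 𝒳)), mul_sum (s := (univ : Finset 𝒴))]
      rw [sum_comm]
      refine sum_congr rfl fun x _ => ?_
      rw [sum_comm]
      refine sum_congr rfl fun y _ => ?_
      rw [← sum_prod_mul_sum hpW1, mul_sum, mul_sum, mul_sum, ← sum_add_distrib]
      exact sum_congr rfl fun c _ => by ring
    rw [e]
    have e' : (∑ x, ∑ y, ∑ w, J x y w * (if G x y w then 0 else 1)) + Real.exp (-(N / κ)) +
          2 * (N / m * τ) = ∑ x, ∑ y, ((∑ w, J x y w * (if G x y w then 0 else 1)) +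
            q x y * Real.exp (-(N / κ)) + q x y * (2 * (N / m * τ))) := by
      simp only [sum_add_distrib, ← sum_mul, hq1, one_mul]
    rw [e']
    refine sum_le_sum fun x _ => sum_le_sum fun y _ => add_le_add (hA_sum x y) ?_
    refine mul_le_mul_of_nonneg_left ?_ (hq0 x y)
    have : ∑ w, pW w * T x y w ≤ 2 * τ := by
      simp only [hT, mul_add, sum_add_distrib]
      linarith [hX x, hY y]
    calc 1 / (m : ℝ) * (N * ∑ w, pW w * T x y w) ≤ 1 / (m : ℝ) * (N * (2 * τ)) := by gcongr
      _ = _ := by ring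
  -- Derandomisation in two stages: a good codebook first, then a good binning for it.
  obtain ⟨c, hc⟩ := exists_le_of_weighted_sum_le (w := fun c : Fin N → 𝒲 => ∏ i, pW (c i))
    (fun c => prod_nonneg fun i _ => hpW _) (by rw [sum_prod_pi_const, hpW1, one_pow]) hΨ_sum
  have : Nonempty (Fin m) := ⟨⟨0, hm⟩⟩
  obtain ⟨b, -, hb'⟩ := exists_le_of_sum_le univ_nonempty (hb c)
  exact ⟨fun x y => b (ι c x y), fun j y => c (kY c b j y), fun j x => c (kX c b j x),
    hb'.trans hc⟩

/-! ### Achievability of rates by random coding -/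

theorem sum_triple_pi {X Y W : Type} [Fintype X] [Fintype Y] [Fintype W] {n : ℕ}
    (F : (Fin n → X × Y × W) → ℝ) :
    ∑ z, F z = ∑ x : Fin n → X, ∑ y : Fin n → Y, ∑ w : Fin n → W, F fun i => (x i, y i, w i) := by
  rw [← (Equiv.arrowProdEquivProdArrow (Fin n) (fun _ => X) fun _ => Y × W).symm.sum_comp,
    Fintype.sum_prod_type]
  refine sum_congr rfl fun x _ => ?_
  rw [← (Equiv.arrowProdEquivProdArrow (Fin n) (fun _ => Y) fun _ => W).symm.sum_comp,
    Fintype.sum_prod_type]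
  rfl

open Classical in
theorem eventually_prob_sum_gt_le_triple {X Y W : Type} [Fintype X] [Fintype Y] [Fintype W]
    {J : X → Y → W → ℝ} (hJ : ∀ x y w, 0 ≤ J x y w) (hJ1 : ∑ x, ∑ y, ∑ w, J x y w = 1)
    (f : X → Y → W → ℝ) {μ δ η : ℝ} (hμ : ∑ x, ∑ y, ∑ w, J x y w * f x y w ≤ μ) (hδ : 0 < δ)
    (hη : 0 < η) :
    ∀ᶠ n : ℕ in Filter.atTop, ∑ x : Fin n → X, ∑ y : Fin n → Y, ∑ w : Fin n → W,
      (∏ i, J (x i) (y i) (w i)) *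
        (if n * (μ + δ) < ∑ i, f (x i) (y i) (w i) then 1 else 0) ≤ η := by
  have := eventually_prob_sum_gt_le (P := fun z : X × Y × W => J z.1 z.2.1 z.2.2)
    (fun z => hJ _ _ _) (by simpa only [Fintype.sum_prod_type] using hJ1)
    (fun z => f z.1 z.2.1 z.2.2) (by simpa only [Fintype.sum_prod_type] using hμ) hδ hη
  filter_upwards [this] with n hn
  rwa [sum_triple_pi] at hn

theorem lt_sum_log_of_exp_lt_prod {n : ℕ} {f : Fin n → ℝ} (hf : ∀ i, 0 < f i) {t : ℝ}
    (h : Real.exp t < ∏ i, f i) : t < ∑ i, Real.log (f i) := by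
  rw [← Real.log_prod fun i _ => (hf i).ne']
  exact (Real.lt_log_iff_exp_lt (prod_pos fun i _ => hf i)).2 h

theorem hamming_le_one {α : Type} [DecidableEq α] (a b : α) : hamming a b ≤ 1 := by
  unfold hamming; split_ifs <;> norm_num

theorem sum_hamming_div_le_one {α : Type} [DecidableEq α] {n : ℕ} (x y : Fin n → α) :
    (∑ i, hamming (x i) (y i)) / n ≤ 1 := by
  refine div_le_one_of_le₀ ?_ n.cast_nonneg
  simpa using sum_le_sum fun i (_ : i ∈ (univ : Finset (Fin n))) => hamming_le_one (x i) (y i)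

theorem ceil_exp_le {t : ℝ} (ht : 0 ≤ t) : (⌈Real.exp t⌉₊ : ℝ) ≤ 2 * Real.exp t := by
  have := Nat.ceil_lt_add_one (Real.exp_nonneg t)
  have := Real.one_le_exp ht
  linarith

open Classical in
/-- Random coding: if `J` is a joint law of the source pair and an auxiliary variable `W`, then
`max (I(X,Y;W) - I(X;W)) (I(X,Y;W) - I(Y;W))` is achievable with common reconstructions that are
functions of `W`. The kernels `κX` and `κY` are the decoding metrics. -/
theorem mem_crRates_of_joint {X Y W : Type} [Fintype X] [Fintype Y] [Fintype W] [DecidableEq X]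
    [DecidableEq Y]
    {q : X × Y → ℝ} {J : X → Y → W → ℝ} {pW : W → ℝ} {κX : X → W → ℝ} {κY : Y → W → ℝ}
    (a : W → X) (b : W → Y)
    (hJ : ∀ x y w, 0 ≤ J x y w) (hq : ∀ x y, ∑ w, J x y w = q (x, y))
    (hq1 : ∑ x, ∑ y, q (x, y) = 1) (hpW : ∀ w, 0 ≤ pW w) (hpW1 : ∑ w, pW w = 1)
    (hκX : ∀ x w, 0 ≤ κX x w) (hκX1 : ∀ x, ∑ w, κX x w ≤ 1)
    (hκY : ∀ y w, 0 ≤ κY y w) (hκY1 : ∀ y, ∑ w, κY y w ≤ 1)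
    (hsupp : ∀ x y w, 0 < J x y w → 0 < pW w ∧ 0 < κX x w ∧ 0 < κY y w) {I₀ I₁ R d₁ d₂ : ℝ}
    (hI₀ : ∑ x, ∑ y, ∑ w, J x y w * Real.log (J x y w / (q (x, y) * pW w)) ≤ I₀) (hI₀0 : 0 ≤ I₀)
    (hIX : ∑ x, ∑ y, ∑ w, J x y w * Real.log (pW w / κX x w) ≤ -I₁)
    (hIY : ∑ x, ∑ y, ∑ w, J x y w * Real.log (pW w / κY y w) ≤ -I₁)
    (hR : 0 ≤ R) (hR' : I₀ - I₁ ≤ R * Real.log 2) (hd₁0 : 0 ≤ d₁) (hd₂0 : 0 ≤ d₂)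
    (hd₁ : ∑ x, ∑ y, ∑ w, J x y w * hamming x (a w) ≤ d₁)
    (hd₂ : ∑ x, ∑ y, ∑ w, J x y w * hamming y (b w) ≤ d₂) :
    R ∈ crRates q hamming hamming d₁ d₂ := by
  have hJ1 : ∑ x, ∑ y, ∑ w, J x y w = 1 := by simp only [hq, hq1]
  have hq0 : ∀ x y, 0 ≤ q (x, y) := fun x y => by rw [← hq]; exact sum_nonneg fun w _ => hJ x y w
  refine ⟨hR, fun ε hε => ?_⟩
  -- The exponents of `N` and `m` exceed `I₀` and `R log 2` by `2δ` and `4δ`. Covering and packing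
  -- are then each left with a margin `δ`, and the rate pays `4δ = ε/4`, which is at most `(ε/2) log
  -- 2`.
  set δ := ε / 16 with hδ
  have hδ0 : 0 < δ := by positivity
  -- Error budget: five atypicality events, one covering term and four packing units of `ε/20` add
  -- up to `ε/2`.
  have hη0 : 0 < ε / 20 := by positivity
  have ev1 := eventually_prob_sum_gt_le_triple hJ hJ1 _ hI₀ hδ0 hη0
  have ev2 := eventually_prob_sum_gt_le_triple hJ hJ1 _ hIX hδ0 hη0
  have ev3 := eventually_prob_sum_gt_le_triple hJ hJ1 _ hIY hδ0 hη0
  have ev4 := eventually_prob_sum_gt_le_triple hJ hJ1 _ hd₁ hδ0 hη0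
  have ev5 := eventually_prob_sum_gt_le_triple hJ hJ1 _ hd₂ hδ0 hη0
  have ev6 : ∀ᶠ n : ℕ in Filter.atTop, Real.exp (-(n * δ)) ≤ ε / 20 := by
    have : Filter.Tendsto (fun n : ℕ => Real.exp (-(n * δ))) Filter.atTop (nhds 0) :=
      Real.tendsto_exp_neg_atTop_nhds_zero.comp
        (tendsto_natCast_atTop_atTop.atTop_mul_const hδ0)
    exact this.eventually_le_const hη0
  have ev7 : ∀ᶠ n : ℕ in Filter.atTop, 2 / ε ≤ n :=
    tendsto_natCast_atTop_atTop.eventually_ge_atTop _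
  obtain ⟨n, h1, h2, h3, h4, h5, h6, h7, hn⟩ := (ev1.and (ev2.and (ev3.and (ev4.and (ev5.and
    (ev6.and (ev7.and (Filter.eventually_gt_atTop 0)))))))).exists
  have hn' : (0 : ℝ) < n := by exact_mod_cast hn
  set N := ⌈Real.exp (n * (I₀ + 2 * δ))⌉₊ with hN
  set m := ⌈Real.exp (n * (R * Real.log 2 + 4 * δ))⌉₊ with hm
  have hN0 : 0 < N := Nat.ceil_pos.2 (Real.exp_pos _)
  have hm0 : 0 < m := Nat.ceil_pos.2 (Real.exp_pos _)
  have hm0' : (0 : ℝ) < m := by exact_mod_cast hm0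
  have hlog2 : 0 < Real.log 2 := Real.log_pos (by norm_num)
  set qn : (Fin n → X) → (Fin n → Y) → ℝ := fun x y => ∏ i, q (x i, y i) with hqn
  set Jn : (Fin n → X) → (Fin n → Y) → (Fin n → W) → ℝ := fun x y w => ∏ i, J (x i) (y i) (w i)
    with hJn
  set pn : (Fin n → W) → ℝ := fun w => ∏ i, pW (w i) with hpn
  set κ := Real.exp (n * (I₀ + δ)) with hκ
  set TX : (Fin n → X) → (Fin n → W) → Prop := fun x w =>
    pn w * Real.exp (n * (I₁ - δ)) ≤ ∏ i, κX (x i) (w i) with hTX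
  set TY : (Fin n → Y) → (Fin n → W) → Prop := fun y w =>
    pn w * Real.exp (n * (I₁ - δ)) ≤ ∏ i, κY (y i) (w i) with hTY
  set G : (Fin n → X) → (Fin n → Y) → (Fin n → W) → Prop := fun x y w =>
    Jn x y w ≤ κ * (qn x y * pn w) ∧ TX x w ∧ TY y w ∧
      ∑ i, hamming (x i) (a (w i)) ≤ n * (d₁ + δ) ∧ ∑ i, hamming (y i) (b (w i)) ≤ n * (d₂ + δ)
    with hG
  have hJn0 : ∀ x y w, 0 ≤ Jn x y w := fun x y w => prod_nonneg fun i _ => hJ _ _ _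
  have hpn0 : ∀ w, 0 ≤ pn w := fun w => prod_nonneg fun i _ => hpW _
  have hqn0 : ∀ x y, 0 ≤ qn x y := fun x y => prod_nonneg fun i _ => hq0 _ _
  have hJq : ∀ x y, ∑ w, Jn x y w = qn x y := fun x y => by
    simp only [hJn, hqn]
    rw [sum_prod_pi fun i => J (x i) (y i)]
    exact prod_congr rfl fun i _ => hq _ _
  have hqn1 : ∑ x, ∑ y, qn x y = 1 := by
    have := sum_prod_pi_const n fun z : X × Y => q z
    rw [Fintype.sum_prod_type, hq1, one_pow,
      ← (Equiv.arrowProdEquivProdArrow (Fin n) (fun _ => X) fun _ => Y).symm.sum_comp,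
      Fintype.sum_prod_type] at this
    exact this
  -- Markov's inequality: only row sums at most one matter, so a decoding metric need not be the
  -- true conditional law.
  have htyp : ∀ {V : Type} [Fintype V] (κV : V → W → ℝ) (_ : ∀ v w, 0 ≤ κV v w)
      (_ : ∀ v, ∑ w, κV v w ≤ 1) (v : Fin n → V),
      ∑ w, pn w * (if pn w * Real.exp (n * (I₁ - δ)) ≤ ∏ i, κV (v i) (w i) then 1 else 0) ≤
        Real.exp (-(n * (I₁ - δ))) := by
    intro V _ κV hκV hκV1 v
    calc _ ≤ ∑ w : Fin n → W, Real.exp (-(n * (I₁ - δ))) * ∏ i, κV (v i) (w i) := by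
          refine sum_le_sum fun w _ => ?_
          have hpos : 0 ≤ ∏ i, κV (v i) (w i) := prod_nonneg fun i _ => hκV _ _
          split_ifs with h
          · rw [Real.exp_neg, inv_mul_eq_div, le_div_iff₀ (Real.exp_pos _)]
            linarith
          · rw [mul_zero]
            positivity
      _ = Real.exp (-(n * (I₁ - δ))) * ∏ i, ∑ w, κV (v i) w := by
          rw [← mul_sum, sum_prod_pi fun i => κV (v i)]
      _ ≤ Real.exp (-(n * (I₁ - δ))) * 1 := by
          gcongr
          exact prod_le_one (fun i _ => sum_nonneg fun w _ => hκV _ _) fun i _ => hκV1 _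
      _ = _ := mul_one _
  obtain ⟨enc, D₁, D₂, hcode⟩ := exists_binning_code hJn0 hJq hqn1 hpn0
    (by rw [sum_prod_pi_const, hpW1, one_pow]) (G := G) (TX := TX) (TY := TY)
    (fun x y w h => h.2.1) (fun x y w h => h.2.2.1) (κ := κ) (Real.exp_pos _)
    (fun x y w h => h.1) (τ := Real.exp (-(n * (I₁ - δ)))) (htyp κX hκX hκX1) (htyp κY hκY hκY1)
    hN0 hm0
  -- Failure of `G` is a union of five upper deviations of letter sums. Where `Jn` is positive,
  -- `hsupp` makes the arguments of all logarithms positive.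
  have hatyp : ∀ x y w, Jn x y w * (if G x y w then 0 else 1) ≤
      Jn x y w * (if n * (I₀ + δ) < ∑ i, Real.log (J (x i) (y i) (w i) /
        (q (x i, y i) * pW (w i))) then 1 else 0) +
      Jn x y w * (if n * (-I₁ + δ) < ∑ i, Real.log (pW (w i) / κX (x i) (w i)) then 1 else 0) +
      Jn x y w * (if n * (-I₁ + δ) < ∑ i, Real.log (pW (w i) / κY (y i) (w i)) then 1 else 0) +
      Jn x y w * (if n * (d₁ + δ) < ∑ i, hamming (x i) (a (w i)) then 1 else 0) +
      Jn x y w * (if n * (d₂ + δ) < ∑ i, hamming (y i) (b (w i)) then 1 else 0) := by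
    intro x y w
    rcases (hJn0 x y w).eq_or_lt with h0 | h0
    · simp [← h0]
    have hJpos : ∀ i, 0 < J (x i) (y i) (w i) := fun i =>
      (hJ _ _ _).lt_of_ne' (prod_ne_zero_iff.1 h0.ne' i (mem_univ _))
    have hs := fun i => hsupp _ _ _ (hJpos i)
    have hqpos : ∀ i, 0 < q (x i, y i) := fun i => by
      rw [← hq]
      exact (hJpos i).trans_le (single_le_sum (fun w _ => hJ (x i) (y i) w) (mem_univ (w i)))
    have hpnpos : 0 < pn w := prod_pos fun i _ => (hs i).1
    have hqnpos : 0 < qn x y := prod_pos fun i _ => hqpos i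
    rw [← mul_add, ← mul_add, ← mul_add, ← mul_add]
    refine mul_le_mul_of_nonneg_left ?_ h0.le
    have htyp' : ∀ κV : Fin n → ℝ, (∀ i, 0 < κV i) →
        ¬ pn w * Real.exp (n * (I₁ - δ)) ≤ ∏ i, κV i →
        n * (-I₁ + δ) < ∑ i, Real.log (pW (w i) / κV i) := by
      intro κV hκV h
      refine lt_sum_log_of_exp_lt_prod (fun i => div_pos (hs i).1 (hκV i)) ?_
      rw [prod_div_distrib, lt_div_iff₀ (prod_pos fun i _ => hκV i),
        show n * (-I₁ + δ) = -(n * (I₁ - δ)) by ring, Real.exp_neg, inv_mul_eq_div,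
        div_lt_iff₀ (Real.exp_pos _)]
      exact not_le.1 h
    by_cases hg : G x y w
    · rw [if_pos hg]
      positivity
    · rw [if_neg hg]
      have hcase : (n * (I₀ + δ) < ∑ i, Real.log (J (x i) (y i) (w i) /
          (q (x i, y i) * pW (w i)))) ∨
          (n * (-I₁ + δ) < ∑ i, Real.log (pW (w i) / κX (x i) (w i))) ∨
          (n * (-I₁ + δ) < ∑ i, Real.log (pW (w i) / κY (y i) (w i))) ∨
          (n * (d₁ + δ) < ∑ i, hamming (x i) (a (w i))) ∨
          (n * (d₂ + δ) < ∑ i, hamming (y i) (b (w i))) := by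
        by_contra! hcon
        refine hg ⟨?_, ?_, ?_, hcon.2.2.2⟩
        · by_contra h
          refine absurd hcon.1 (not_le.2 (lt_sum_log_of_exp_lt_prod
            (fun i => div_pos (hJpos i) (mul_pos (hqpos i) (hs i).1)) ?_))
          rw [prod_div_distrib, prod_mul_distrib, lt_div_iff₀ (mul_pos hqnpos hpnpos)]
          exact not_le.1 h
        · by_contra h
          exact absurd hcon.2.1 (not_le.2 (htyp' _ (fun i => (hs i).2.1) h))
        · by_contra h
          exact absurd hcon.2.2.1 (not_le.2 (htyp' _ (fun i => (hs i).2.2) h))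
      rcases hcase with h | h | h | h | h <;> rw [if_pos h] <;> split_ifs <;> norm_num
  have hatyp_sum : ∑ x, ∑ y, ∑ w, Jn x y w * (if G x y w then 0 else 1) ≤ 5 * (ε / 20) := by
    refine (sum_le_sum fun x _ => sum_le_sum fun y _ => sum_le_sum fun w _ =>
      hatyp x y w).trans ?_
    simp only [sum_add_distrib]
    linarith
  have hexpN : Real.exp (-(N / κ)) ≤ ε / 20 := by
    refine le_trans ?_ h6
    rw [Real.exp_le_exp, neg_le_neg_iff, le_div_iff₀ (Real.exp_pos _)]
    refine le_trans ?_ (Nat.le_ceil _)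
    have : n * δ ≤ Real.exp (n * δ) := by linarith [Real.add_one_le_exp (n * δ)]
    calc n * δ * κ ≤ Real.exp (n * δ) * κ := mul_le_mul_of_nonneg_right this (Real.exp_nonneg _)
      _ = _ := by rw [hκ, ← Real.exp_add]; ring_nf
  have hpack : N / m * Real.exp (-(n * (I₁ - δ))) ≤ 2 * (ε / 20) := by
    have e1 : (N : ℝ) / m ≤ 2 * Real.exp (n * (I₀ + 2 * δ)) /
        Real.exp (n * (R * Real.log 2 + 4 * δ)) :=
      div_le_div₀ (by positivity) (ceil_exp_le (by positivity)) (Real.exp_pos _) (Nat.le_ceil _)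
    calc _ ≤ 2 * Real.exp (n * (I₀ + 2 * δ)) / Real.exp (n * (R * Real.log 2 + 4 * δ)) *
          Real.exp (-(n * (I₁ - δ))) := by gcongr
      _ = 2 * Real.exp (-(n * δ) + n * (I₀ - I₁ - R * Real.log 2)) := by
          rw [mul_div_assoc, ← Real.exp_sub, mul_assoc, ← Real.exp_add]
          ring_nf
      _ ≤ 2 * Real.exp (-(n * δ)) := by
          gcongr
          have := mul_nonneg hn'.le (sub_nonneg.2 hR')
          linarith
      _ ≤ _ := by gcongr
  set bad : (Fin n → X) → (Fin n → Y) → ℝ := fun x y =>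
    if G x y (D₁ (enc x y) y) ∧ D₂ (enc x y) x = D₁ (enc x y) y then 0 else 1 with hbad
  have hbad_sum : ∑ x, ∑ y, qn x y * bad x y ≤ ε / 2 := by
    refine (le_of_eq ?_).trans (hcode.trans ?_)
    · refine sum_congr rfl fun x _ => sum_congr rfl fun y _ => ?_
      simp only [hbad]
      congr
    · refine (add_le_add (add_le_add (le_trans (le_of_eq ?_) hatyp_sum) hexpN)
        (mul_le_mul_of_nonneg_left hpack zero_le_two)).trans (by linarith)
      refine sum_congr rfl fun x _ => sum_congr rfl fun y _ => sum_congr rfl fun w _ => ?_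
      congr
  have hblock : ∀ (F : (Fin n → X) → (Fin n → Y) → ℝ) (t : ℝ), (∀ x y, F x y ≤ t + bad x y) →
      blockExp q F ≤ t + ε / 2 := by
    intro F t hF
    calc blockExp q F ≤ ∑ x, ∑ y, qn x y * (t + bad x y) :=
          sum_le_sum fun x _ => sum_le_sum fun y _ => mul_le_mul_of_nonneg_left (hF x y) (hqn0 x y)
      _ = t + ∑ x, ∑ y, qn x y * bad x y := by
          simp only [mul_add, sum_add_distrib, ← sum_mul, hqn1, one_mul]
      _ ≤ _ := by gcongr
  have hbad0 : ∀ x y, 0 ≤ bad x y := fun x y => by simp only [hbad]; split_ifs <;> norm_num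
  refine ⟨n, m, hn,
    { enc := enc
      dec₁ := fun j y i => a (D₁ j y i)
      dec₂ := fun j x i => b (D₂ j x i)
      cr₁ := fun j y i => b (D₁ j y i)
      cr₂ := fun j x i => a (D₂ j x i) }, ?_, ?_, ?_, ?_⟩
  · rw [codeRate, Real.logb, div_div, div_le_iff₀ (by positivity)]
    have e1 : Real.log m ≤ Real.log 2 + n * (R * Real.log 2 + 4 * δ) := by
      rw [Real.log_le_iff_le_exp hm0', Real.exp_add, Real.exp_log two_pos]
      exact ceil_exp_le (by positivity)
    have e2 : 1 / 2 ≤ Real.log 2 := by linarith [Real.log_two_gt_d9]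
    rw [div_le_iff₀ hε] at h7
    have e3 : Real.log 2 * 2 ≤ Real.log 2 * (n * ε) := by gcongr
    have e4 : n * ε * (1 / 2) ≤ n * ε * Real.log 2 := by gcongr
    have e5 : n * (4 * δ) = n * ε * (1 / 2) / 2 := by rw [hδ]; ring
    nlinarith
  · refine (hblock _ (d₁ + δ) fun x y => ?_).trans (by rw [hδ]; linarith)
    simp only [RDCode.hatX, hbad]
    split_ifs with h
    · rw [add_zero, div_le_iff₀ hn', mul_comm]
      exact h.1.2.2.2.1
    · have := sum_hamming_div_le_one x fun i => a (D₁ (enc x y) y i)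
      linarith
  · refine (hblock _ (d₂ + δ) fun x y => ?_).trans (by rw [hδ]; linarith)
    simp only [RDCode.hatY, hbad]
    split_ifs with h
    · rw [add_zero, div_le_iff₀ hn', mul_comm, h.2]
      exact h.1.2.2.2.2
    · have := sum_hamming_div_le_one y fun i => b (D₂ (enc x y) x i)
      linarith
  · refine (max_le (hblock _ 0 fun x y => ?_) (hblock _ 0 fun x y => ?_)).trans (by linarith)
    · by_cases h : G x y (D₁ (enc x y) y) ∧ D₂ (enc x y) x = D₁ (enc x y) y
      · simp [CRCode.tildeX, RDCode.hatX, hbad, h.2, h.1]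
      · simp only [hbad, if_neg h]
        split_ifs <;> norm_num
    · by_cases h : G x y (D₁ (enc x y) y) ∧ D₂ (enc x y) x = D₁ (enc x y) y
      · simp [CRCode.tildeY, RDCode.hatY, hbad, h.2, h.1]
      · simp only [hbad, if_neg h]
        split_ifs <;> norm_num

/-! ### Two auxiliary variables for the doubly symmetric binary source -/

/-- The binary symmetric channel with crossover probability `d`. -/
def bsc (d : ℝ) (x u : Fin 2) : ℝ := if x = u then 1 - d else d

theorem bsc_nonneg {d : ℝ} (h0 : 0 ≤ d) (h1 : d ≤ 1) (x u : Fin 2) : 0 ≤ bsc d x u := by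
  unfold bsc; split_ifs <;> linarith

theorem sum_bsc (d : ℝ) (x : Fin 2) : ∑ u, bsc d x u = 1 := by
  fin_cases x <;> simp [bsc]

theorem log_two_pos : 0 < Real.log 2 := Real.log_pos one_lt_two

theorem binEntropy_eq_neg (p : ℝ) :
    Real.binEntropy p = -(p * Real.log p + (1 - p) * Real.log (1 - p)) := by
  rw [Real.binEntropy_eq_negMulLog_add_negMulLog_one_sub, Real.negMulLog, Real.negMulLog]
  ring

theorem mul_log_div_two (p : ℝ) : p * Real.log (p / 2) = p * Real.log p - p * Real.log 2 := by
  rcases eq_or_ne p 0 with rfl | hp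
  · simp
  · rw [Real.log_div hp two_ne_zero]
    ring

/-- Take the chain `X - U - V - Y`, with `(U,V)` of crossover `r` and both outer channels of
crossover `d`, and `W = (U,V)`. Then `I(X,Y;W) = 1 + h(ρ) - 2h(d)` and `I(X;W) = I(Y;W) = 1 - h(d)`.
The decoding metrics are the true conditional laws of `W`; their factor `2` is `1/P(x)`. -/
theorem h_sub_h_mem_crRates {ρ d : ℝ} (hρ : ρ ∈ Set.Icc (0 : ℝ) (1 / 2))
    (hd : d ∈ Set.Icc (0 : ℝ) (1 / 2)) (hdρ : 2 * d * (1 - d) ≤ ρ) :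
    h ρ - h d ∈ crRates (dsbs ρ) hamming hamming d d := by
  obtain ⟨hρ0, hρ1⟩ := hρ
  obtain ⟨hd0, hd1⟩ := hd
  have hlog := log_two_pos
  -- Solves for `r` the requirement that the three cascaded channels have total crossover `ρ`. If
  -- `2d(1-d) = 1/2`, then `ρ = 1/2` and any `r` serves.
  obtain ⟨r, hr0, hr1, hr⟩ : ∃ r : ℝ, 0 ≤ r ∧ r ≤ 1 / 2 ∧
      r * (1 - 2 * (2 * d * (1 - d))) + 2 * d * (1 - d) = ρ := by
    rcases (show 2 * d * (1 - d) ≤ 1 / 2 by nlinarith [sq_nonneg (d - 1 / 2)]).eq_or_lt with h | h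
    · exact ⟨0, le_rfl, by norm_num, by linarith⟩
    · have : 0 < 1 - 2 * (2 * d * (1 - d)) := by linarith
      refine ⟨(ρ - 2 * d * (1 - d)) / (1 - 2 * (2 * d * (1 - d))), div_nonneg (by linarith) this.le,
        ?_, ?_⟩
      · rw [div_le_iff₀ this]; linarith
      · rw [div_mul_cancel₀ _ this.ne']; ring
  have hdρ' : d ≤ ρ := by nlinarith
  have hmono : Real.binEntropy d ≤ Real.binEntropy ρ :=
    Real.binEntropy_strictMonoOn.monotoneOn ⟨hd0, by linarith⟩ ⟨hρ0, by linarith⟩ hdρ'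
  have hble : Real.binEntropy d ≤ Real.log 2 := Real.binEntropy_le_log_two
  have hB := fun x u => bsc_nonneg hd0 (by linarith) x u
  have hp : ∀ w, 0 ≤ dsbs r w := (dsbs_mem_stdSimplex ⟨hr0, hr1⟩).1
  have hJpos : ∀ (x y : Fin 2) (w : Fin 2 × Fin 2), dsbs r w * bsc d x w.1 * bsc d y w.2 ≠ 0 →
      0 < dsbs r w ∧ 0 < bsc d x w.1 ∧ 0 < bsc d y w.2 := by
    intro x y w h
    simp only [ne_eq, mul_eq_zero, not_or] at h
    exact ⟨(hp w).lt_of_ne' h.1.1, (hB _ _).lt_of_ne' h.1.2, (hB _ _).lt_of_ne' h.2⟩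
  have hlin : ∀ (x y : Fin 2), ∑ w : Fin 2 × Fin 2, dsbs r w * bsc d x w.1 * bsc d y w.2 =
      dsbs ρ (x, y) := by
    intro x y
    rw [Fintype.sum_prod_type]
    fin_cases x <;> fin_cases y <;> simp [dsbs, bsc] <;> rw [← hr] <;> ring
  refine mem_crRates_of_joint (W := Fin 2 × Fin 2)
    (J := fun x y w => dsbs r w * bsc d x w.1 * bsc d y w.2) (pW := dsbs r)
    (κX := fun x w => 2 * dsbs r w * bsc d x w.1) (κY := fun y w => 2 * dsbs r w * bsc d y w.2)
    Prod.fst Prod.snd (I₀ := Real.log 2 + Real.binEntropy ρ - 2 * Real.binEntropy d)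
    (I₁ := Real.log 2 - Real.binEntropy d) (fun x y w => ?_) hlin ?_ hp ?_ (fun x w => ?_)
    (fun x => ?_) (fun x w => ?_) (fun x => ?_) (fun x y w hJ => ?_) ?_ ?_ ?_ ?_ ?_ ?_ hd0 hd0 ?_ ?_
  · exact mul_nonneg (mul_nonneg (hp _) (hB _ _)) (hB _ _)
  · simpa only [Fintype.sum_prod_type] using (dsbs_mem_stdSimplex ⟨hρ0, hρ1⟩).2
  · exact (dsbs_mem_stdSimplex ⟨hr0, hr1⟩).2
  · have := hp w
    have := hB x w.1
    positivity
  · refine le_of_eq ?_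
    rw [Fintype.sum_prod_type]
    fin_cases x <;> simp [dsbs, bsc] <;> ring
  · have := hp w
    have := hB x w.2
    positivity
  · refine le_of_eq ?_
    rw [Fintype.sum_prod_type]
    fin_cases x <;> simp [dsbs, bsc] <;> ring
  · obtain ⟨h1, h2, h3⟩ := hJpos x y w hJ.ne'
    exact ⟨h1, by positivity, by positivity⟩
  · refine le_of_eq ?_
    have e : ∀ (x y : Fin 2) (w : Fin 2 × Fin 2), dsbs r w * bsc d x w.1 * bsc d y w.2 *
        Real.log (dsbs r w * bsc d x w.1 * bsc d y w.2 / (dsbs ρ (x, y) * dsbs r w)) =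
        dsbs r w * bsc d x w.1 * bsc d y w.2 * (Real.log (bsc d x w.1) + Real.log (bsc d y w.2)) -
        dsbs r w * bsc d x w.1 * bsc d y w.2 * Real.log (dsbs ρ (x, y)) := by
      intro x y w
      by_cases h : dsbs r w * bsc d x w.1 * bsc d y w.2 = 0
      · simp [h]
      · obtain ⟨h1, h2, h3⟩ := hJpos x y w h
        have h4 : 0 < dsbs ρ (x, y) := by
          rw [← hlin]
          refine lt_of_lt_of_le ?_ (single_le_sum (fun w _ => ?_) (mem_univ w))
          · positivity
          · exact mul_nonneg (mul_nonneg (hp _) (hB _ _)) (hB _ _)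
        rw [← mul_sub, show dsbs r w * bsc d x w.1 * bsc d y w.2 / (dsbs ρ (x, y) * dsbs r w) =
          bsc d x w.1 * bsc d y w.2 / dsbs ρ (x, y) by field_simp, Real.log_div (by positivity)
          h4.ne', Real.log_mul h2.ne' h3.ne']
    simp only [e, sum_sub_distrib, ← sum_mul, hlin]
    have e1 := mul_log_div_two ρ
    have e2 := mul_log_div_two (1 - ρ)
    simp only [Fintype.sum_prod_type, Fin.sum_univ_two]
    simp [dsbs, bsc]
    rw [binEntropy_eq_neg, binEntropy_eq_neg]
    linear_combination -e1 - e2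
  · linarith
  · refine le_of_eq ?_
    have e : ∀ (x y : Fin 2) (w : Fin 2 × Fin 2), dsbs r w * bsc d x w.1 * bsc d y w.2 *
        Real.log (dsbs r w / (2 * dsbs r w * bsc d x w.1)) =
        dsbs r w * bsc d x w.1 * bsc d y w.2 * (-Real.log 2 - Real.log (bsc d x w.1)) := by
      intro x y w
      by_cases h : dsbs r w * bsc d x w.1 * bsc d y w.2 = 0
      · simp [h]
      · obtain ⟨h1, h2, h3⟩ := hJpos x y w h
        rw [show dsbs r w / (2 * dsbs r w * bsc d x w.1) = (2 * bsc d x w.1)⁻¹ by field_simp,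
          Real.log_inv, Real.log_mul two_ne_zero h2.ne']
        ring
    simp only [e]
    simp only [Fintype.sum_prod_type, Fin.sum_univ_two]
    simp [dsbs, bsc]
    rw [binEntropy_eq_neg]
    ring
  · refine le_of_eq ?_
    have e : ∀ (x y : Fin 2) (w : Fin 2 × Fin 2), dsbs r w * bsc d x w.1 * bsc d y w.2 *
        Real.log (dsbs r w / (2 * dsbs r w * bsc d y w.2)) =
        dsbs r w * bsc d x w.1 * bsc d y w.2 * (-Real.log 2 - Real.log (bsc d y w.2)) := by
      intro x y w
      by_cases h : dsbs r w * bsc d x w.1 * bsc d y w.2 = 0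
      · simp [h]
      · obtain ⟨h1, h2, h3⟩ := hJpos x y w h
        rw [show dsbs r w / (2 * dsbs r w * bsc d y w.2) = (2 * bsc d y w.2)⁻¹ by field_simp,
          Real.log_inv, Real.log_mul two_ne_zero h3.ne']
        ring
    simp only [e]
    simp only [Fintype.sum_prod_type, Fin.sum_univ_two]
    simp [dsbs, bsc]
    rw [binEntropy_eq_neg]
    ring
  · rw [h, h, ← sub_div]
    exact div_nonneg (by linarith) hlog.le
  · rw [h, h, ← sub_div, div_mul_cancel₀ _ hlog.ne']
    linarith
  · refine le_of_eq ?_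
    simp only [Fintype.sum_prod_type, Fin.sum_univ_two]
    simp [dsbs, bsc, hamming]
    ring
  · refine le_of_eq ?_
    simp only [Fintype.sum_prod_type, Fin.sum_univ_two]
    simp [dsbs, bsc, hamming]
    ring

/-- One bit `W` serves as both reconstructions: the common value sent through a channel of crossover
`t` when `X = Y`, a fair coin otherwise. Here `t` makes `P(W ≠ X) = ρ/2 + (1-ρ)t` equal to `d`; then
`I(X,Y;W) = (1-ρ)(1 - h(t))` and `I(X;W) = 1 - h(d)`. -/
theorem upper_bound_mem_crRates {ρ d : ℝ} (hρ : ρ ∈ Set.Icc (0 : ℝ) (1 / 2)) (hd0 : 0 < d)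
    (hd1 : d ≤ 1 / 2) (hdρ : ρ ≤ 2 * d) :
    h d - ρ - (1 - ρ) * h ((2 * d - ρ) / (2 * (1 - ρ))) ∈
      crRates (dsbs ρ) hamming hamming d d := by
  obtain ⟨hρ0, hρ1⟩ := hρ
  have hlog := log_two_pos
  have hρ' : 0 < 1 - ρ := by linarith
  obtain ⟨t, ht⟩ : ∃ t, t = (2 * d - ρ) / (2 * (1 - ρ)) := ⟨_, rfl⟩
  rw [← ht]
  have htd : ρ * (1 / 2) + (1 - ρ) * t = d := by rw [ht]; field_simp; ring
  have ht0 : 0 ≤ t := by rw [ht]; exact div_nonneg (by linarith) (by linarith)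
  have ht1 : t ≤ 1 / 2 := by rw [ht, div_le_iff₀ (by linarith)]; linarith
  clear ht
  have hble : Real.binEntropy t ≤ Real.log 2 := Real.binEntropy_le_log_two
  -- Concavity at the mixture `d` of `1/2` and `t`; this is nonnegativity of the rate.
  have hconc : ρ * Real.log 2 + (1 - ρ) * Real.binEntropy t ≤ Real.binEntropy d := by
    have := Real.strictConcave_binEntropy.concaveOn.2 (x := 1 / 2) (y := t)
      ⟨by norm_num, by norm_num⟩ ⟨ht0, by linarith⟩ hρ0 hρ'.le (by ring)
    simp only [smul_eq_mul, htd] at this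
    simpa [Real.binEntropy_two_inv] using this
  have hBt := fun x u => bsc_nonneg ht0 (by linarith) x u
  have hBd : ∀ x u, 0 < bsc d x u := fun x u => by unfold bsc; split_ifs <;> linarith
  refine mem_crRates_of_joint (W := Fin 2)
    (J := fun x y w => if x = y then (1 - ρ) / 2 * bsc t x w else ρ / 2 * (1 / 2))
    (pW := fun _ => 1 / 2) (κX := bsc d) (κY := bsc d) id id
    (I₀ := (1 - ρ) * (Real.log 2 - Real.binEntropy t))
    (I₁ := Real.log 2 - Real.binEntropy d) (fun x y w => ?_) (fun x y => ?_) ?_ (fun w => ?_) ?_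
    (fun x w => (hBd _ _).le) (fun x => (sum_bsc d x).le) (fun x w => (hBd _ _).le)
    (fun x => (sum_bsc d x).le) (fun x y w _ => ⟨by norm_num, hBd _ _, hBd _ _⟩)
    ?_ ?_ ?_ ?_ ?_ ?_ hd0.le hd0.le ?_ ?_
  · split_ifs
    · exact mul_nonneg (by linarith) (hBt _ _)
    · linarith
  · fin_cases x <;> fin_cases y <;> simp [dsbs, bsc] <;> ring
  · simpa only [Fintype.sum_prod_type] using (dsbs_mem_stdSimplex ⟨hρ0, hρ1⟩).2
  · norm_num
  · simp
  · refine le_of_eq ?_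
    have e : ∀ x y w : Fin 2, (if x = y then (1 - ρ) / 2 * bsc t x w else ρ / 2 * (1 / 2)) *
        Real.log ((if x = y then (1 - ρ) / 2 * bsc t x w else ρ / 2 * (1 / 2)) /
          (dsbs ρ (x, y) * (1 / 2))) =
        if x = y then (1 - ρ) / 2 * bsc t x w * (Real.log 2 + Real.log (bsc t x w)) else 0 := by
      intro x y w
      by_cases hxy : x = y
      · simp only [if_pos hxy, dsbs]
        rcases (hBt x w).eq_or_lt with h0 | h0
        · simp [← h0]
        · rw [← Real.log_mul two_ne_zero h0.ne']
          congr 2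
          field_simp
      · simp only [if_neg hxy, dsbs]
        rcases hρ0.eq_or_lt with h0 | h0
        · simp [← h0]
        · rw [div_self (by positivity), Real.log_one, mul_zero]
    simp only [e]
    simp [bsc, Fin.sum_univ_two]
    rw [binEntropy_eq_neg]
    ring
  · exact mul_nonneg hρ'.le (by linarith)
  · refine le_of_eq ?_
    have e : ∀ x w : Fin 2, Real.log (1 / 2 / bsc d x w) =
        -Real.log 2 - Real.log (bsc d x w) := by
      intro x w
      rw [Real.log_div (by norm_num) (hBd _ _).ne', one_div, Real.log_inv]
    simp only [e]
    simp [bsc, Fin.sum_univ_two]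
    rw [binEntropy_eq_neg, ← htd]
    ring
  · refine le_of_eq ?_
    have e : ∀ x w : Fin 2, Real.log (1 / 2 / bsc d x w) =
        -Real.log 2 - Real.log (bsc d x w) := by
      intro x w
      rw [Real.log_div (by norm_num) (hBd _ _).ne', one_div, Real.log_inv]
    simp only [e]
    simp [bsc, Fin.sum_univ_two]
    rw [binEntropy_eq_neg, ← htd]
    ring
  · rw [h, h, show Real.binEntropy d / Real.log 2 - ρ - (1 - ρ) * (Real.binEntropy t / Real.log 2) =
      (Real.binEntropy d - ρ * Real.log 2 - (1 - ρ) * Real.binEntropy t) / Real.log 2 by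
      field_simp]
    exact div_nonneg (by linarith) hlog.le
  · rw [h, h]
    refine le_of_eq ?_
    field_simp
    ring
  · refine le_of_eq ?_
    simp [hamming, bsc, Fin.sum_univ_two]
    rw [← htd]
    ring
  · refine le_of_eq ?_
    simp [hamming, bsc, Fin.sum_univ_two]
    rw [← htd]
    ring

/-! ### Conditional entropy of a bit and Fano-type bounds -/

/-- The conditional entropy (in nats) of the first component of a pair with law `P`. -/
def condEnt {V : Type} [Fintype V] (P : Fin 2 → V → ℝ) : ℝ :=
  ∑ v, ((∑ x, Real.negMulLog (P x v)) - Real.negMulLog (∑ x, P x v))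

theorem sum_fin_two_flip {M : Type} [AddCommMonoid M] (F : Fin 2 → M) (u : Fin 2) :
    ∑ x, F x = F (u + 1) + F u := by
  fin_cases u
  · simp [Fin.sum_univ_two, add_comm]
  · simp [Fin.sum_univ_two]

theorem negMulLog_add_sub {p r : ℝ} (hp : 0 ≤ p) (hr : 0 ≤ r) :
    Real.negMulLog p + Real.negMulLog r - Real.negMulLog (p + r) =
      (p + r) * Real.binEntropy (p / (p + r)) := by
  rcases (add_nonneg hp hr).eq_or_lt with h0 | h0
  · have hp0 : p = 0 := by linarith
    have hr0 : r = 0 := by linarith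
    simp [hp0, hr0]
  · have e1 : 1 - p / (p + r) = r / (p + r) := by field_simp; ring
    rw [Real.binEntropy_eq_negMulLog_add_negMulLog_one_sub, e1]
    have key : ∀ a : ℝ, (p + r) * Real.negMulLog (a / (p + r)) =
        Real.negMulLog a + a * Real.log (p + r) := by
      intro a
      rcases eq_or_ne a 0 with rfl | ha
      · simp
      · simp only [Real.negMulLog]
        rw [Real.log_div ha h0.ne']
        field_simp
        ring
    rw [mul_add, key, key]
    simp only [Real.negMulLog]
    ring

/-- In `Fin 2` the element `a v + 1` is the flipped bit, so both sides are the error probability of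
the estimate `a`. -/
theorem sum_flip_eq {V : Type} [Fintype V] (P : Fin 2 → V → ℝ) (a : V → Fin 2) :
    ∑ v, P (a v + 1) v = ∑ v, ∑ x, P x v * hamming x (a v) := by
  refine sum_congr rfl fun v _ => ?_
  rw [sum_fin_two_flip _ (a v)]
  simp [hamming]

/-- Jensen's inequality for the conditional entropy of a bit, given an estimate `a` of it. -/
theorem condEnt_le {V : Type} [Fintype V] {P : Fin 2 → V → ℝ} (h0 : ∀ x v, 0 ≤ P x v)
    (h1 : ∑ v, ∑ x, P x v = 1) (a : V → Fin 2) :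
    condEnt P ≤ Real.binEntropy (∑ v, P (a v + 1) v) ∧
    (Real.binEntropy (∑ v, P (a v + 1) v) ≤ condEnt P →
      ∀ v, P (a v + 1) v = (∑ x, P x v) * ∑ v, P (a v + 1) v) := by
  have hs0 : ∀ v, 0 ≤ ∑ x, P x v := fun v => sum_nonneg fun x _ => h0 x v
  set p : V → ℝ := fun v => P (a v + 1) v / ∑ x, P x v with hp
  have e1 : condEnt P = ∑ v, (∑ x, P x v) • Real.binEntropy (p v) := by
    refine sum_congr rfl fun v _ => ?_
    simp only [hp]
    rw [sum_fin_two_flip _ (a v), sum_fin_two_flip (fun x => P x v) (a v)]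
    exact negMulLog_add_sub (h0 _ _) (h0 _ _)
  have e2 : ∀ v, (∑ x, P x v) • p v = P (a v + 1) v := by
    intro v
    have := h0 (a v) v
    have := h0 (a v + 1) v
    simp only [hp, smul_eq_mul]
    rcases (hs0 v).eq_or_lt with h | h
    · rw [← h, zero_mul]
      rw [sum_fin_two_flip _ (a v)] at h
      linarith
    · rw [mul_div_cancel₀ _ h.ne']
  have e3 : ∑ v, P (a v + 1) v = ∑ v, (∑ x, P x v) • p v := sum_congr rfl fun v _ => (e2 v).symm
  have hmem : ∀ v ∈ (univ : Finset V), p v ∈ Set.Icc (0 : ℝ) 1 := by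
    intro v _
    refine ⟨div_nonneg (h0 _ _) (hs0 v), div_le_one_of_le₀ ?_ (hs0 v)⟩
    exact single_le_sum (f := fun x => P x v) (fun x _ => h0 x v) (mem_univ _)
  have hle := Real.strictConcave_binEntropy.concaveOn.le_map_sum (fun v _ => hs0 v) h1 hmem
  rw [e1]
  refine ⟨by rwa [e3], fun hge v => ?_⟩
  -- Equality in strict Jensen: the conditional error probability is the same at every `v` of
  -- positive mass.
  have heq := (Real.strictConcave_binEntropy.map_sum_eq_iff' (fun v _ => hs0 v) h1 hmem).1
    (le_antisymm (by rwa [e3] at hge) hle) v (mem_univ v)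
  rw [← e2 v, smul_eq_mul]
  by_cases h : ∑ x, P x v = 0
  · rw [h, zero_mul, zero_mul]
  · rw [heq h, e3]

/-- Binary entropy decreases beyond `1/2`, and the bound `D = d + ε` may lie there; capping restores
monotonicity. -/
theorem binEntropy_le_of_le {e D : ℝ} (he : 0 ≤ e) (heD : e ≤ D) :
    Real.binEntropy e ≤ Real.binEntropy (min D (1 / 2)) := by
  rcases le_total D (1 / 2) with h | h
  · rw [min_eq_left h]
    exact Real.binEntropy_strictMonoOn.monotoneOn ⟨he, by linarith⟩ ⟨he.trans heD, by linarith⟩ heD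
  · rw [min_eq_right h, one_div, Real.binEntropy_two_inv]
    exact Real.binEntropy_le_log_two

/-! ### Letter laws of a block code -/

section Letter

variable {X Y : Type} [Fintype X] [Fintype Y] {q : X × Y → ℝ} {n : ℕ}

theorem sum_sum_prod_eq_one (h1 : ∑ z, q z = 1) :
    ∑ x : Fin n → X, ∑ y : Fin n → Y, ∏ i, q (x i, y i) = 1 := by
  have := sum_prod_pi_const n q
  rw [h1, one_pow, ← (Equiv.arrowProdEquivProdArrow (Fin n) (fun _ => X) fun _ => Y).symm.sum_comp,
    Fintype.sum_prod_type] at this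
  exact this

theorem blockExp_mono (h0 : ∀ z, 0 ≤ q z) {F G : (Fin n → X) → (Fin n → Y) → ℝ}
    (h : ∀ x y, F x y ≤ G x y) : blockExp q F ≤ blockExp q G :=
  sum_le_sum fun x _ => sum_le_sum fun y _ =>
    mul_le_mul_of_nonneg_left (h x y) (prod_nonneg fun _ _ => h0 _)

theorem blockExp_add (F G : (Fin n → X) → (Fin n → Y) → ℝ) :
    blockExp q (fun x y => F x y + G x y) = blockExp q F + blockExp q G := by
  simp only [blockExp, mul_add, sum_add_distrib]

theorem blockExp_mul_const (F : (Fin n → X) → (Fin n → Y) → ℝ) (c : ℝ) :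
    blockExp q (fun x y => F x y * c) = blockExp q F * c := by
  simp only [blockExp, sum_mul, mul_assoc]

theorem blockExp_sum {S : Type} [Fintype S] (F : S → (Fin n → X) → (Fin n → Y) → ℝ) :
    blockExp q (fun x y => ∑ s, F s x y) = ∑ s, blockExp q (F s) := by
  simp only [blockExp, mul_sum]
  rw [sum_comm (s := (univ : Finset S))]
  refine sum_congr rfl fun x _ => ?_
  rw [sum_comm]

theorem blockExp_const (h1 : ∑ z, q z = 1) (c : ℝ) :
    blockExp q (fun (_ : Fin n → X) (_ : Fin n → Y) => c) = c := by
  simp only [blockExp, ← sum_mul, sum_sum_prod_eq_one h1, one_mul]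

variable {S : Type} [DecidableEq S]

/-- The law of `F (𝐗, 𝐘) I` for a uniformly random index `I`. -/
def avgLaw (q : X × Y → ℝ) (F : (Fin n → X) → (Fin n → Y) → Fin n → S) (s : S) : ℝ :=
  blockExp q fun x y => (∑ i, if F x y i = s then (1 : ℝ) else 0) / n

/-- Single-letterisation: block averages, distortions in particular, become linear functionals of
one letter law. -/
theorem sum_avgLaw_mul [Fintype S] (F : (Fin n → X) → (Fin n → Y) → Fin n → S) (g : S → ℝ) :
    ∑ s, avgLaw q F s * g s = blockExp q fun x y => (∑ i, g (F x y i)) / n := by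
  simp only [avgLaw, ← blockExp_mul_const]
  rw [← blockExp_sum]
  congr 1
  funext x y
  rw [sum_div]
  simp only [sum_div, sum_mul]
  rw [sum_comm]
  refine sum_congr rfl fun i _ => ?_
  rw [sum_eq_single (F x y i)]
  · simp; ring
  · intro b _ hb
    simp [hb.symm]
  · simp

theorem avgLaw_nonneg (h0 : ∀ z, 0 ≤ q z) (F : (Fin n → X) → (Fin n → Y) → Fin n → S) (s : S) :
    0 ≤ avgLaw q F s :=
  sum_nonneg fun x _ => sum_nonneg fun y _ => mul_nonneg (prod_nonneg fun _ _ => h0 _)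
    (div_nonneg (sum_nonneg fun i _ => by split_ifs <;> norm_num) n.cast_nonneg)

theorem sum_avgLaw [Fintype S] (h1 : ∑ z, q z = 1) (hn : 0 < n)
    (F : (Fin n → X) → (Fin n → Y) → Fin n → S) : ∑ s, avgLaw q F s = 1 := by
  have := sum_avgLaw_mul (q := q) F fun _ => 1
  simp only [mul_one] at this
  rw [this]
  have hn' : (n : ℝ) ≠ 0 := by positivity
  simp [hn', blockExp_const h1]

theorem avgLaw_mem_stdSimplex [Fintype S] (hq : q ∈ stdSimplex ℝ (X × Y)) (hn : 0 < n)
    (F : (Fin n → X) → (Fin n → Y) → Fin n → S) : avgLaw q F ∈ stdSimplex ℝ S :=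
  ⟨avgLaw_nonneg hq.1 F, sum_avgLaw hq.2 hn F⟩

theorem blockExp_letter (h1 : ∑ z, q z = 1) (hn : 0 < n) (g : X × Y → ℝ) :
    blockExp q (fun (x : Fin n → X) y => (∑ i, g (x i, y i)) / n) = ∑ z, q z * g z := by
  have h2 := sum_prod_mul_sum h1 n g
  rw [← (Equiv.arrowProdEquivProdArrow (Fin n) (fun _ => X) fun _ => Y).symm.sum_comp,
    Fintype.sum_prod_type] at h2
  have hn' : (n : ℝ) ≠ 0 := by positivity
  simp only [div_eq_mul_inv]
  rw [blockExp_mul_const, ← div_eq_mul_inv, div_eq_iff hn', mul_comm _ (n : ℝ), ← h2]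
  rfl

/-- Lets the letter laws seen by the two receivers be identified when reconstruction disagreements
are rare. -/
theorem abs_avgLaw_sub_le (h0 : ∀ z, 0 ≤ q z) (hn : 0 < n)
    (F F' : (Fin n → X) → (Fin n → Y) → Fin n → S) (s : S) :
    |avgLaw q F s - avgLaw q F' s| ≤ blockExp q fun x y => if F x y ≠ F' x y then 1 else 0 := by
  have hn' : (0 : ℝ) < n := by exact_mod_cast hn
  have key : ∀ F F' : (Fin n → X) → (Fin n → Y) → Fin n → S, avgLaw q F s ≤
      avgLaw q F' s + blockExp q fun x y => if F x y ≠ F' x y then 1 else 0 := by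
    intro F F'
    rw [avgLaw, avgLaw, ← blockExp_add]
    refine blockExp_mono h0 fun x y => ?_
    by_cases h : F x y = F' x y
    · simp [h]
    · rw [if_pos h]
      have e1 : (∑ i, if F x y i = s then (1 : ℝ) else 0) / n ≤ 1 := by
        refine div_le_one_of_le₀ ?_ hn'.le
        calc _ ≤ ∑ i : Fin n, (1 : ℝ) := sum_le_sum fun i _ => by split_ifs <;> norm_num
          _ = n := by simp
      have e2 : 0 ≤ (∑ i, if F' x y i = s then (1 : ℝ) else 0) / n :=
        div_nonneg (sum_nonneg fun i _ => by split_ifs <;> norm_num) hn'.le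
      linarith
  have k1 := key F F'
  have k2 := key F' F
  simp only [ne_comm (a := F' _ _)] at k2
  rw [abs_le]
  constructor <;> linarith

end Letter

/-! ### The converse -/

/-- Since `Y` is uniform, `2 * dsbs ρ (x, y)` is the conditional probability of `x` given `y`, and
the sum is `-H(X|Y)`. -/
theorem sum_dsbs_mul_log (ρ : ℝ) :
    ∑ z, dsbs ρ z * Real.log (2 * dsbs ρ z) = -Real.binEntropy ρ := by
  rw [binEntropy_eq_neg]
  simp [dsbs, Fintype.sum_prod_type, Fin.sum_univ_two, mul_div_cancel₀]
  ring

/-- Single-letter converse: a message that, together with `𝐘`, determines the sequence `α` has rate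
at least `H(X|Y) - H(X|A,Y)`, where `(X, A, Y)` has the averaged letter law. -/
theorem binEntropy_sub_condEnt_le {ρ : ℝ} (hρ : ρ ∈ Set.Icc (0 : ℝ) (1 / 2)) {n m : ℕ} (hn : 0 < n)
    {A : Type} [Fintype A] [DecidableEq A] (enc : (Fin n → Fin 2) → (Fin n → Fin 2) → Fin m)
    (α : Fin m → (Fin n → Fin 2) → Fin n → A) :
    Real.binEntropy ρ - condEnt (fun (x : Fin 2) (v : A × Fin 2) =>
      avgLaw (dsbs ρ) (fun xs ys i => (xs i, α (enc xs ys) ys i, ys i)) (x, v)) ≤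
        Real.log m / n := by
  have hn' : (0 : ℝ) < n := by exact_mod_cast hn
  have hm : 0 < m := (Nat.zero_le _).trans_lt (enc 0 0).2
  have hm' : (0 : ℝ) < m := by exact_mod_cast hm
  have hq := dsbs_mem_stdSimplex hρ
  set F : (Fin n → Fin 2) → (Fin n → Fin 2) → Fin n → Fin 2 × (A × Fin 2) :=
    fun xs ys i => (xs i, α (enc xs ys) ys i, ys i) with hF
  set P := avgLaw (dsbs ρ) F with hP
  have hP0 : ∀ s, 0 ≤ P s := avgLaw_nonneg hq.1 F
  set Q : Fin 2 → A × Fin 2 → ℝ := fun x v => P (x, v) / ∑ x, P (x, v) with hQ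
  have hS0 : ∀ v, 0 ≤ ∑ x, P (x, v) := fun v => sum_nonneg fun x _ => hP0 _
  have hQ0 : ∀ x v, 0 ≤ Q x v := fun x v => div_nonneg (hP0 _) (hS0 v)
  -- `Q` is the conditional law of `X` given `(A, Y)`; its row is zero where `v` has no mass, as
  -- division by zero is zero.
  have hQ1 : ∀ v, ∑ x, Q x v ≤ 1 := fun v => by
    simp only [hQ, ← sum_div]
    exact div_self_le_one _
  set g : Fin 2 × (A × Fin 2) → ℝ := fun s =>
    Real.log (Q s.1 s.2) - Real.log (2 * dsbs ρ (s.1, s.2.2)) with hg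
  -- A change of measure in place of the entropy chain rule: `log t ≤ t - 1` at the likelihood ratio
  -- of `Q` to the source conditional law, divided by `m`.
  have hpt : ∀ xs ys, (∏ i, dsbs ρ (xs i, ys i)) * ((∑ i, g (F xs ys i)) - Real.log m + 1) ≤
      (2 ^ n : ℝ)⁻¹ / m * ∏ i, Q (F xs ys i).1 (F xs ys i).2 := by
    intro xs ys
    have hw0 : 0 ≤ ∏ i, dsbs ρ (xs i, ys i) := prod_nonneg fun _ _ => hq.1 _
    have hQn : 0 ≤ ∏ i, Q (F xs ys i).1 (F xs ys i).2 := prod_nonneg fun _ _ => hQ0 _ _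
    rcases hw0.eq_or_lt with h | h
    · rw [← h, zero_mul]
      positivity
    have hqpos : ∀ i, 0 < dsbs ρ (xs i, ys i) := fun i =>
      (hq.1 _).lt_of_ne' (prod_ne_zero_iff.1 h.ne' i (mem_univ _))
    have hPpos : ∀ i, 0 < P (F xs ys i) := by
      intro i
      have h1 : 0 < (∏ i, dsbs ρ (xs i, ys i)) *
          ((∑ j, if F xs ys j = F xs ys i then (1 : ℝ) else 0) / n) := by
        refine mul_pos h (div_pos (sum_pos' (fun j _ => by split_ifs <;> norm_num) ?_) hn')
        exact ⟨i, mem_univ _, by simp⟩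
      have hterm : ∀ xs' ys', 0 ≤ (∏ i, dsbs ρ (xs' i, ys' i)) *
          ((∑ j, if F xs' ys' j = F xs ys i then (1 : ℝ) else 0) / n) := fun xs' ys' =>
        mul_nonneg (prod_nonneg fun _ _ => hq.1 _)
          (div_nonneg (sum_nonneg fun i _ => by split_ifs <;> norm_num) hn'.le)
      refine h1.trans_le ?_
      refine le_trans ?_ (single_le_sum (f := fun xs' => ∑ ys', (∏ i, dsbs ρ (xs' i, ys' i)) *
          ((∑ j, if F xs' ys' j = F xs ys i then (1 : ℝ) else 0) / n))
          (fun xs' _ => sum_nonneg fun ys' _ => hterm xs' ys') (mem_univ xs))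
      exact single_le_sum (f := fun ys' => (∏ i, dsbs ρ (xs i, ys' i)) *
          ((∑ j, if F xs ys' j = F xs ys i then (1 : ℝ) else 0) / n))
          (fun ys' _ => hterm xs ys') (mem_univ ys)
    have hQpos : ∀ i, 0 < Q (F xs ys i).1 (F xs ys i).2 := fun i =>
      div_pos (hPpos i) ((hPpos i).trans_le
        (single_le_sum (f := fun x => P (x, (F xs ys i).2)) (fun x _ => hP0 _) (mem_univ _)))
    have hQn' : 0 < ∏ i, Q (F xs ys i).1 (F xs ys i).2 := prod_pos fun i _ => hQpos i
    have hlog : ∑ i, g (F xs ys i) = Real.log ((∏ i, Q (F xs ys i).1 (F xs ys i).2) /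
        ∏ i, (2 * dsbs ρ (xs i, ys i))) := by
      rw [Real.log_div hQn'.ne' (prod_pos fun i _ => mul_pos two_pos (hqpos i)).ne',
        Real.log_prod fun i _ => (hQpos i).ne',
        Real.log_prod fun i _ => (mul_pos two_pos (hqpos i)).ne', ← sum_sub_distrib]
    have hprod : ∏ i, (2 * dsbs ρ (xs i, ys i)) = 2 ^ n * ∏ i, dsbs ρ (xs i, ys i) := by
      rw [prod_mul_distrib]
      simp
    rw [hlog, hprod]
    set w := ∏ i, dsbs ρ (xs i, ys i)
    set q' := ∏ i, Q (F xs ys i).1 (F xs ys i).2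
    have h3 := Real.log_le_sub_one_of_pos (show 0 < q' / (2 ^ n * w) / m by positivity)
    rw [Real.log_div (by positivity) hm'.ne'] at h3
    calc w * (Real.log (q' / (2 ^ n * w)) - Real.log m + 1) ≤ w * (q' / (2 ^ n * w) / m) :=
          mul_le_mul_of_nonneg_left (by linarith) hw0
      _ = _ := by field_simp
  have hsum : ∑ xs, ∑ ys, (∏ i, dsbs ρ (xs i, ys i)) * ((∑ i, g (F xs ys i)) - Real.log m + 1) ≤
      1 := by
    refine (sum_le_sum fun xs _ => sum_le_sum fun ys _ => hpt xs ys).trans ?_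
    rw [sum_comm]
    have hys : ∀ ys : Fin n → Fin 2, ∑ xs, (2 ^ n : ℝ)⁻¹ / m *
        ∏ i, Q (F xs ys i).1 (F xs ys i).2 ≤ (2 ^ n : ℝ)⁻¹ := by
      intro ys
      rw [← mul_sum]
      -- The actual message is replaced by a sum over all `m`. Once message and `ys` are fixed, so
      -- is `α`, and the product is a subprobability in `xs`.
      have : ∑ xs, ∏ i, Q (F xs ys i).1 (F xs ys i).2 ≤ m := by
        calc _ ≤ ∑ xs : Fin n → Fin 2, ∑ j, ∏ i, Q (xs i) (α j ys i, ys i) := by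
              refine sum_le_sum fun xs _ => ?_
              exact single_le_sum (f := fun j => ∏ i, Q (xs i) (α j ys i, ys i))
                (fun j _ => prod_nonneg fun _ _ => hQ0 _ _) (mem_univ (enc xs ys))
          _ = ∑ j, ∏ i, ∑ x, Q x (α j ys i, ys i) := by
              rw [sum_comm]
              exact sum_congr rfl fun j _ => sum_prod_pi fun i x => Q x (α j ys i, ys i)
          _ ≤ ∑ j : Fin m, (1 : ℝ) := sum_le_sum fun j _ =>
              prod_le_one (fun i _ => sum_nonneg fun x _ => hQ0 _ _) fun i _ => hQ1 _
          _ = m := by simp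
      calc _ ≤ (2 ^ n : ℝ)⁻¹ / m * m := by gcongr
        _ = _ := by field_simp
    refine (sum_le_sum fun ys _ => hys ys).trans ?_
    simp
  have hmain : ∑ s, P s * g s ≤ Real.log m / n := by
    rw [hP, sum_avgLaw_mul]
    simp only [div_eq_mul_inv]
    rw [blockExp_mul_const]
    refine mul_le_mul_of_nonneg_right ?_ (by positivity)
    simp only [mul_add, mul_sub, sum_add_distrib, sum_sub_distrib, ← sum_mul, mul_one,
      sum_sum_prod_eq_one hq.2, one_mul] at hsum
    simp only [blockExp]
    linarith
  refine le_trans (le_of_eq ?_) hmain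
  have e1 : ∑ s, P s * Real.log (2 * dsbs ρ (s.1, s.2.2)) = -Real.binEntropy ρ := by
    rw [hP, sum_avgLaw_mul, ← sum_dsbs_mul_log ρ,
      ← blockExp_letter hq.2 hn fun z => Real.log (2 * dsbs ρ z)]
  have e2 : ∑ s, P s * Real.log (Q s.1 s.2) = -condEnt (fun x v => P (x, v)) := by
    rw [Fintype.sum_prod_type_right, condEnt, ← sum_neg_distrib]
    refine sum_congr rfl fun v _ => ?_
    simp only [Real.negMulLog, hQ]
    rw [neg_mul, ← neg_mul, neg_sub, ← neg_mul_eq_neg_mul, sum_mul, ← sum_neg_distrib,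
      ← sum_sub_distrib]
    refine sum_congr rfl fun x _ => ?_
    rcases (hP0 (x, v)).eq_or_lt with h | h
    · simp [← h]
    · have : 0 < ∑ x, P (x, v) :=
        h.trans_le (single_le_sum (f := fun x => P (x, v)) (fun x _ => hP0 _) (mem_univ _))
      rw [Real.log_div h.ne' this.ne']
      ring
  simp only [hg, mul_sub, sum_sub_distrib, e1, e2]
  ring

/-- Receiver 1 alone suffices: with `A = X̂`, the converse and Fano give `h(ρ) - h(d + ε) ≤ r + ε`,
capped at `1/2`, and continuity lets `ε` tend to zero. -/
theorem h_sub_h_le_of_mem_rates {ρ d r : ℝ} (hρ : ρ ∈ Set.Icc (0 : ℝ) (1 / 2)) (hd : d ≤ 1 / 2)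
    (hr : r ∈ rates (dsbs ρ) hamming hamming d d) : h ρ - h d ≤ r := by
  have hq := dsbs_mem_stdSimplex hρ
  have key : ∀ ε : ℝ, 0 < ε → h ρ ≤ r + ε + h (min (d + ε) (1 / 2)) := by
    intro ε hε
    obtain ⟨n, m, hn, c, hrate, hd₁, -⟩ := hr.2 ε hε
    have hconv := binEntropy_sub_condEnt_le hρ hn c.enc c.dec₁
    set F : (Fin n → Fin 2) → (Fin n → Fin 2) → Fin n → Fin 2 × (Fin 2 × Fin 2) :=
      fun xs ys i => (xs i, c.dec₁ (c.enc xs ys) ys i, ys i) with hF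
    set P := avgLaw (dsbs ρ) F with hP
    have hP0 : ∀ s, 0 ≤ P s := avgLaw_nonneg hq.1 F
    have hP1 : ∑ v, ∑ x, P (x, v) = 1 := by
      rw [← Fintype.sum_prod_type_right]
      exact sum_avgLaw hq.2 hn F
    have hfano := (condEnt_le (P := fun x v => P (x, v)) (fun x v => hP0 _) hP1 Prod.fst).1
    have herr : ∑ v : Fin 2 × Fin 2, P (v.1 + 1, v) = c.dist₁ (dsbs ρ) hamming := by
      rw [sum_flip_eq (fun x v => P (x, v)) Prod.fst, ← Fintype.sum_prod_type_right
        (f := fun s : Fin 2 × Fin 2 × Fin 2 => P s * hamming s.1 s.2.1), hP, sum_avgLaw_mul]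
      rfl
    have hbin := binEntropy_le_of_le (sum_nonneg fun v _ => hP0 _) (herr.trans_le hd₁)
    have hlog := log_two_pos
    have hn' : (0 : ℝ) < n := by exact_mod_cast hn
    rw [codeRate, Real.logb, div_right_comm, div_le_iff₀ hlog] at hrate
    rw [h, h, ← sub_le_iff_le_add, ← sub_div, div_le_iff₀ hlog]
    linarith
  have hlim : Filter.Tendsto (fun ε : ℝ => r + ε + h (min (d + ε) (1 / 2)))
      (nhdsWithin 0 (Set.Ioi 0)) (nhds (r + 0 + h (min (d + 0) (1 / 2)))) := by
    have : Continuous fun ε : ℝ => r + ε + h (min (d + ε) (1 / 2)) := by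
      unfold h
      fun_prop
    exact (this.tendsto 0).mono_left nhdsWithin_le_nhds
  have := ge_of_tendsto hlim (by
    filter_upwards [self_mem_nhdsWithin] with ε hε using key ε hε)
  rw [add_zero, add_zero, min_eq_left hd] at this
  linarith

/-! ### Strictness of the common-reconstructions bound above `d*` -/

theorem dsbs_comm (ρ : ℝ) (x y : Fin 2) : dsbs ρ (x, y) = dsbs ρ (y, x) := by
  simp only [dsbs, eq_comm]

/-- Source symmetry, by which the converse for receiver 1 also serves receiver 2. -/
theorem blockExp_dsbs_swap (ρ : ℝ) {n : ℕ} (F : (Fin n → Fin 2) → (Fin n → Fin 2) → ℝ) :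
    blockExp (dsbs ρ) (fun y x => F x y) = blockExp (dsbs ρ) F := by
  simp only [blockExp]
  rw [sum_comm]
  refine sum_congr rfl fun x _ => sum_congr rfl fun y _ => ?_
  congr 1
  exact prod_congr rfl fun i _ => dsbs_comm _ _ _

/-- A letter law that meets the converse bounds at both receivers with equality has the structure
`X = U ⊕ N₁`, `Y = V ⊕ N₂` with independent noises, so that `P(X ≠ Y) ≥ 2d(1-d)`. -/
theorem le_of_condEnt_ge {ρ d : ℝ} (hd0 : 0 ≤ d) (hd : d ≤ 1 / 2)
    {P : Fin 2 × (Fin 2 × Fin 2) × Fin 2 → ℝ}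
    (hP : P ∈ stdSimplex ℝ (Fin 2 × (Fin 2 × Fin 2) × Fin 2))
    (hmarg : ∀ x y, ∑ w, P (x, w, y) = dsbs ρ (x, y))
    (hX : Real.binEntropy d ≤ condEnt fun x (v : (Fin 2 × Fin 2) × Fin 2) => P (x, v))
    (hY : Real.binEntropy d ≤ condEnt fun y (v : (Fin 2 × Fin 2) × Fin 2) => P (v.2, v.1, y))
    (hdX : ∑ s, P s * hamming s.1 s.2.1.1 ≤ d) (hdY : ∑ s, P s * hamming s.2.2 s.2.1.2 ≤ d) :
    2 * d * (1 - d) ≤ ρ := by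
  have hP0 := hP.1
  -- Equality in the Fano bound at error at most `d ≤ 1/2` forces error exactly `d`, regardless of
  -- the observation: the bit is its estimate with noise of level `d`.
  have aux : ∀ (R : Fin 2 → (Fin 2 × Fin 2) × Fin 2 → ℝ) (a : (Fin 2 × Fin 2) × Fin 2 → Fin 2),
      (∀ x v, 0 ≤ R x v) → ∑ v, ∑ x, R x v = 1 → Real.binEntropy d ≤ condEnt R →
      ∑ v, R (a v + 1) v ≤ d → ∀ x v, R x v = (∑ x, R x v) * bsc d (a v) x := by
    intro R a h0 h1 hent herr
    have hc := condEnt_le h0 h1 a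
    have he0 : 0 ≤ ∑ v, R (a v + 1) v := sum_nonneg fun v _ => h0 _ _
    have heq : ∑ v, R (a v + 1) v = d := by
      refine le_antisymm herr (not_lt.1 fun hlt => ?_)
      have := Real.binEntropy_strictMonoOn ⟨he0, by linarith⟩ ⟨hd0, by linarith⟩ hlt
      linarith [hc.1]
    have hflip := hc.2 (by rw [heq]; exact hent)
    rw [heq] at hflip
    intro x v
    have hsum := sum_fin_two_flip (fun x => R x v) (a v)
    by_cases hx : a v = x
    · subst hx
      simp only [bsc, if_true]
      linarith [hflip v]
    · have hx' : x = a v + 1 := by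
        generalize a v = u at hx
        revert hx
        fin_cases x <;> fin_cases u <;> simp
      simp only [bsc, if_neg hx]
      rw [← hflip v, hx']
  have hP1 := hP.2
  have h1 := aux (fun x v => P (x, v)) (fun v => v.1.1) (fun _ _ => hP0 _)
    (by rw [← Fintype.sum_prod_type_right]; exact hP1) hX (by
      rw [sum_flip_eq (fun x (v : (Fin 2 × Fin 2) × Fin 2) => P (x, v)) fun v => v.1.1,
        ← Fintype.sum_prod_type_right (f := fun s : Fin 2 × (Fin 2 × Fin 2) × Fin 2 =>
          P s * hamming s.1 s.2.1.1)]
      exact hdX)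
  have hreorder : ∀ f : Fin 2 × (Fin 2 × Fin 2) × Fin 2 → ℝ,
      ∑ v : (Fin 2 × Fin 2) × Fin 2, ∑ y, f (v.2, v.1, y) = ∑ s, f s := by
    intro f
    exact (Fintype.sum_prod_type_right _).trans ((sum_congr rfl fun x _ =>
      (Fintype.sum_prod_type (f := fun p : (Fin 2 × Fin 2) × Fin 2 => f (x, p))).symm).trans
      (Fintype.sum_prod_type f).symm)
  have h2 := aux (fun y v => P (v.2, v.1, y)) (fun v => v.1.2) (fun _ _ => hP0 _)
    (by rw [hreorder P]; exact hP1) hY (by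
      rw [sum_flip_eq (fun y (v : (Fin 2 × Fin 2) × Fin 2) => P (v.2, v.1, y)) fun v => v.1.2,
        hreorder fun s => P s * hamming s.2.2 s.2.1.2]
      exact hdY)
  set T : Fin 2 × Fin 2 → ℝ := fun w => ∑ x, ∑ y, P (x, w, y) with hT
  have hT0 : ∀ w, 0 ≤ T w := fun w => sum_nonneg fun x _ => sum_nonneg fun y _ => hP0 _
  have hT1 : ∑ w, T w = 1 := by
    rw [← hP1, Fintype.sum_prod_type P]
    refine (sum_comm (f := fun w x => ∑ y, P (x, w, y))).trans ?_
    exact sum_congr rfl fun x _ =>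
      (Fintype.sum_prod_type (f := fun p : (Fin 2 × Fin 2) × Fin 2 => P (x, p))).symm
  -- The first receiver's structure makes `X` depend on `(W,Y)` only through `W`; the second, summed
  -- over `x`, gives the law of `Y` given `W`.
  have hfac : ∀ x w y, P (x, w, y) = T w * bsc d w.2 y * bsc d w.1 x := by
    intro x w y
    rw [h1 x (w, y)]
    simp only
    congr 1
    simp only [hT]
    rw [sum_mul]
    exact sum_congr rfl fun x' _ => h2 y (w, x')
  have e01 := hmarg 0 1
  have e10 := hmarg 1 0
  have hsum : ρ = ∑ w, (P (0, w, 1) + P (1, w, 0)) := by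
    rw [sum_add_distrib, e01, e10]
    simp [dsbs]
  calc 2 * d * (1 - d) = ∑ w, T w * (2 * d * (1 - d)) := by rw [← sum_mul, hT1, one_mul]
    _ ≤ ∑ w, (P (0, w, 1) + P (1, w, 0)) := by
        refine sum_le_sum fun w _ => ?_
        rw [hfac, hfac, mul_assoc (T w), mul_assoc (T w), ← mul_add]
        refine mul_le_mul_of_nonneg_left ?_ (hT0 w)
        obtain ⟨u, v⟩ := w
        -- Given `w = (u, v)`, `X ≠ Y` has probability `2d(1-d)` if `u = v`, and `d² + (1-d)²`
        -- otherwise, which is no smaller.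
        fin_cases u <;> fin_cases v <;> simp [bsc] <;> nlinarith [sq_nonneg (1 - 2 * d)]
    _ = ρ := hsum.symm

/-- Receiver 1 knows `(X̂, Ỹ)` and receiver 2 knows `(X̃, Ŷ)`, so the converse applies to both
pairs, with letter laws `P` and `P'` at distance at most `2ε`. In the limit they coincide, and
`le_of_condEnt_ge` applies. Without common reconstructions there would be no single auxiliary pair
for both bounds. -/
theorem le_of_h_sub_h_mem_crRates {ρ d : ℝ} (hρ : ρ ∈ Set.Icc (0 : ℝ) (1 / 2)) (hd0 : 0 ≤ d)
    (hd : d ≤ 1 / 2) (hr : h ρ - h d ∈ crRates (dsbs ρ) hamming hamming d d) :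
    2 * d * (1 - d) ≤ ρ := by
  have hq := dsbs_mem_stdSimplex hρ
  have hlog := log_two_pos
  have key : ∀ ε : ℝ, 0 < ε → ∃ P P' : Fin 2 × (Fin 2 × Fin 2) × Fin 2 → ℝ,
      P ∈ stdSimplex ℝ _ ∧ (∀ s, |P s - P' s| ≤ 2 * ε) ∧
      (∀ x y, ∑ w, P (x, w, y) = dsbs ρ (x, y)) ∧
      (Real.binEntropy d - ε * Real.log 2 ≤
        condEnt fun x (v : (Fin 2 × Fin 2) × Fin 2) => P (x, v)) ∧
      (Real.binEntropy d - ε * Real.log 2 ≤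
        condEnt fun y (v : (Fin 2 × Fin 2) × Fin 2) => P' (v.2, v.1, y)) ∧
      (∑ s, P s * hamming s.1 s.2.1.1 ≤ d + ε) ∧ (∑ s, P' s * hamming s.2.2 s.2.1.2 ≤ d + ε) := by
    intro ε hε
    obtain ⟨n, m, hn, c, hrate, hd₁, hd₂, herr⟩ := hr.2 ε hε
    have hn' : (0 : ℝ) < n := by exact_mod_cast hn
    set F : (Fin n → Fin 2) → (Fin n → Fin 2) → Fin n → Fin 2 × (Fin 2 × Fin 2) × Fin 2 :=
      fun xs ys i => (xs i, (c.hatX xs ys i, c.tildeY xs ys i), ys i) with hF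
    set F' : (Fin n → Fin 2) → (Fin n → Fin 2) → Fin n → Fin 2 × (Fin 2 × Fin 2) × Fin 2 :=
      fun xs ys i => (xs i, (c.tildeX xs ys i, c.hatY xs ys i), ys i) with hF'
    have hrate' : Real.log m / n ≤ Real.binEntropy ρ - Real.binEntropy d + ε * Real.log 2 := by
      rw [codeRate, Real.logb, div_right_comm, div_le_iff₀ hlog, h, h] at hrate
      refine hrate.trans_eq ?_
      field_simp
    refine ⟨avgLaw (dsbs ρ) F, avgLaw (dsbs ρ) F', avgLaw_mem_stdSimplex hq hn F, fun s => ?_,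
      fun x y => ?_, ?_, ?_, ?_, ?_⟩
    · refine (abs_avgLaw_sub_le hq.1 hn F F' s).trans ?_
      have hle := blockExp_mono (q := dsbs ρ) hq.1
        (F := fun xs ys => if F xs ys ≠ F' xs ys then (1 : ℝ) else 0)
        (G := fun xs ys => (if c.tildeX xs ys ≠ c.hatX xs ys then 1 else 0) +
          (if c.tildeY xs ys ≠ c.hatY xs ys then 1 else 0)) (by
        intro xs ys
        by_cases h1 : c.tildeX xs ys = c.hatX xs ys
        · by_cases h2 : c.tildeY xs ys = c.hatY xs ys
          · have : F xs ys = F' xs ys := by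
              funext i
              simp only [hF, hF', h1, h2]
            simp [this, h1, h2]
          · simp only [h1, ne_eq, not_true_eq_false, if_false, h2, not_false_eq_true, if_true]
            split_ifs <;> norm_num
        · simp only [h1, ne_eq, not_false_eq_true, if_true]
          split_ifs <;> norm_num)
      rw [blockExp_add] at hle
      have := (le_max_left _ _).trans herr
      have := (le_max_right _ _).trans herr
      linarith
    · have e1 := sum_avgLaw_mul (q := dsbs ρ) F fun s => if (s.1, s.2.2) = (x, y) then 1 else 0
      have e2 := blockExp_letter hq.2 hn fun z => if z = (x, y) then (1 : ℝ) else 0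
      rw [show (blockExp (dsbs ρ) fun xs ys => (∑ i, if ((F xs ys i).1, (F xs ys i).2.2) = (x, y)
        then (1 : ℝ) else 0) / n) = _ from e2] at e1
      have e3 : ∑ z, dsbs ρ z * (if z = (x, y) then (1 : ℝ) else 0) = dsbs ρ (x, y) := by
        simp only [mul_ite, mul_one, mul_zero, sum_ite_eq', mem_univ, if_true]
      rw [← e3, ← e1]
      set g : Fin 2 × (Fin 2 × Fin 2) × Fin 2 → ℝ := fun s =>
        avgLaw (dsbs ρ) F s * (if (s.1, s.2.2) = (x, y) then (1 : ℝ) else 0) with hg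
      symm
      calc ∑ s, g s = ∑ x', ∑ p, g (x', p) := Fintype.sum_prod_type _
        _ = ∑ p, g (x, p) := sum_eq_single x
          (fun x' _ hx' => sum_eq_zero fun p _ => by simp [hg, hx']) (by simp)
        _ = ∑ w, ∑ y', g (x, w, y') := Fintype.sum_prod_type _
        _ = ∑ w, avgLaw (dsbs ρ) F (x, w, y) := sum_congr rfl fun w _ => by simp [hg]
    · have := binEntropy_sub_condEnt_le hρ hn c.enc fun j ys i => (c.dec₁ j ys i, c.cr₁ j ys i)
      linarith!
    -- The converse with the two sources exchanged, for receiver 2.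
    · have := binEntropy_sub_condEnt_le hρ hn (fun ys xs => c.enc xs ys)
        fun j xs i => (c.cr₂ j xs i, c.dec₂ j xs i)
      have e : ∀ (y : Fin 2) (v : (Fin 2 × Fin 2) × Fin 2),
          avgLaw (dsbs ρ) (fun ys xs i => (ys i, (c.cr₂ (c.enc xs ys) xs i,
            c.dec₂ (c.enc xs ys) xs i), xs i)) (y, v) = avgLaw (dsbs ρ) F' (v.2, v.1, y) := by
        rintro y ⟨w, x⟩
        rw [avgLaw, avgLaw, ← blockExp_dsbs_swap]
        congr 1
        funext ys xs
        congr 1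
        refine sum_congr rfl fun i _ => ?_
        simp only [hF', Prod.mk.injEq, CRCode.tildeX, RDCode.hatY]
        congr 1
        exact propext ⟨fun ⟨a, b, c⟩ => ⟨c, b, a⟩, fun ⟨a, b, c⟩ => ⟨c, b, a⟩⟩
      simp only [e] at this
      linarith
    · rw [sum_avgLaw_mul]
      exact hd₁
    · rw [sum_avgLaw_mul]
      exact hd₂
  set ε : ℕ → ℝ := fun k => 1 / ((k : ℝ) + 1) with hε
  have hεlim : Filter.Tendsto ε Filter.atTop (nhds 0) := tendsto_one_div_add_atTop_nhds_zero_nat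
  choose P P' hPs hPP' hmarg hX hY hdX hdY using fun k : ℕ => key (ε k) Nat.one_div_pos_of_nat
  -- The letter laws live on a fixed finite alphabet whatever the block lengths, so compactness of
  -- one simplex suffices.
  obtain ⟨L, hL, φ, hφ, hlim⟩ := (isCompact_stdSimplex ℝ _).tendsto_subseq hPs
  have hεφ := hεlim.comp hφ.tendsto_atTop
  have hlim' : Filter.Tendsto (P' ∘ φ) Filter.atTop (nhds L) := by
    rw [tendsto_pi_nhds] at hlim ⊢
    intro s
    have hdiff : Filter.Tendsto (fun k => P (φ k) s - P' (φ k) s) Filter.atTop (nhds 0) := by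
      refine squeeze_zero_norm (fun k => hPP' (φ k) s) ?_
      simpa using hεφ.const_mul 2
    simpa using (hlim s).sub hdiff
  have hentlim : Filter.Tendsto (fun k => Real.binEntropy d - ε (φ k) * Real.log 2) Filter.atTop
      (nhds (Real.binEntropy d)) := by
    simpa using (hεφ.mul_const (Real.log 2)).const_sub (Real.binEntropy d)
  have hdlim : Filter.Tendsto (fun k => d + ε (φ k)) Filter.atTop (nhds d) := by
    simpa using hεφ.const_add d
  refine le_of_condEnt_ge hd0 hd hL (fun x y => ?_) ?_ ?_ ?_ ?_
  · have hcont : Continuous fun P : Fin 2 × (Fin 2 × Fin 2) × Fin 2 → ℝ => ∑ w, P (x, w, y) := by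
      fun_prop
    exact tendsto_nhds_unique ((hcont.tendsto L).comp hlim)
      (tendsto_const_nhds.congr fun k => (hmarg (φ k) x y).symm)
  · have hcont : Continuous fun P : Fin 2 × (Fin 2 × Fin 2) × Fin 2 → ℝ =>
        condEnt fun x (v : (Fin 2 × Fin 2) × Fin 2) => P (x, v) := by
      unfold condEnt
      fun_prop
    exact le_of_tendsto_of_tendsto' hentlim ((hcont.tendsto L).comp hlim) fun k => hX (φ k)
  · have hcont : Continuous fun P : Fin 2 × (Fin 2 × Fin 2) × Fin 2 → ℝ =>
        condEnt fun y (v : (Fin 2 × Fin 2) × Fin 2) => P (v.2, v.1, y) := by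
      unfold condEnt
      fun_prop
    exact le_of_tendsto_of_tendsto' hentlim ((hcont.tendsto L).comp hlim') fun k => hY (φ k)
  · have hcont : Continuous fun P : Fin 2 × (Fin 2 × Fin 2) × Fin 2 → ℝ =>
        ∑ s, P s * hamming s.1 s.2.1.1 := by
      fun_prop
    exact le_of_tendsto_of_tendsto' ((hcont.tendsto L).comp hlim) hdlim fun k => hdX (φ k)
  · have hcont : Continuous fun P : Fin 2 × (Fin 2 × Fin 2) × Fin 2 → ℝ =>
        ∑ s, P s * hamming s.2.2 s.2.1.2 := by
      fun_prop
    exact le_of_tendsto_of_tendsto' ((hcont.tendsto L).comp hlim') hdlim fun k => hdY (φ k)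

/-! ### The rate-distortion function of a uniform bit -/

theorem mutualInfo_eq_sub_condEnt {V : Type} [Fintype V] (P : Fin 2 × V → ℝ) :
    mutualInfo P = entropy (fstMarg P) - condEnt (fun x v => P (x, v)) / Real.log 2 := by
  simp only [mutualInfo, entropy, condEnt, sndMarg, sum_sub_distrib, Fintype.sum_prod_type_right]
  ring

theorem entropy_uniform_bit : entropy (fun _ : Fin 2 => (1 / 2 : ℝ)) = 1 := by
  have := log_two_pos
  simp only [entropy, Fin.sum_univ_two, Real.negMulLog, one_div, Real.log_inv]
  field_simp
  ring

theorem fstMarg_joint {α β : Type} [Fintype β] (q : α → ℝ) {p : α → β → ℝ} (hp : IsChannel p) :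
    fstMarg (joint q p) = q := by
  funext a
  simp only [fstMarg, joint, ← mul_sum, (hp a).2, mul_one]

/-- The channel `bsc d` attains the value; the lower bound is Fano's, with `X̂` as both observation
and estimate. -/
theorem marginalRD_uniform_bit {d : ℝ} (hd0 : 0 ≤ d) (hd : d ≤ 1 / 2) :
    marginalRD (fun _ : Fin 2 => (1 / 2 : ℝ)) hamming d = 1 - h d := by
  have hlog := log_two_pos
  refine IsLeast.csInf_eq ⟨⟨bsc d, fun x => ⟨fun u => bsc_nonneg hd0 (by linarith) x u,
    sum_bsc d x⟩, ?_, ?_⟩, ?_⟩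
  · refine le_of_eq ?_
    simp [Fin.sum_univ_two, bsc, hamming]
    ring
  · rw [mutualInfo_eq_sub_condEnt, fstMarg_joint _ fun x =>
      ⟨fun u => bsc_nonneg hd0 (by linarith) x u, sum_bsc d x⟩, entropy_uniform_bit, h]
    congr 2
    have e1 := negMulLog_add_sub (p := 1 / 2 * d) (r := 1 / 2 * (1 - d)) (by linarith)
      (by linarith)
    rw [show 1 / 2 * d + 1 / 2 * (1 - d) = 1 / 2 by ring,
      show 1 / 2 * d / (1 / 2) = d by ring] at e1
    have e2 : 1 / 2 * (1 - d) + 1 / 2 * d = 1 / 2 := by ring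
    have e3 : 1 / 2 * d + 1 / 2 * (1 - d) = 1 / 2 := by ring
    simp only [condEnt, joint, bsc, Fin.sum_univ_two, if_true, zero_ne_one, one_ne_zero, if_false,
      e2, e3]
    linarith
  · rintro r ⟨p, hp, hdist, rfl⟩
    rw [mutualInfo_eq_sub_condEnt, fstMarg_joint _ hp, entropy_uniform_bit, h]
    have h0 : ∀ x v, 0 ≤ joint (fun _ : Fin 2 => (1 / 2 : ℝ)) p (x, v) := fun x v =>
      mul_nonneg (by norm_num) ((hp x).1 v)
    have h1 : ∑ v, ∑ x, joint (fun _ : Fin 2 => (1 / 2 : ℝ)) p (x, v) = 1 := by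
      rw [sum_comm]
      simp only [joint, ← mul_sum, (hp _).2]
      simp
    have hc := (condEnt_le h0 h1 id).1
    have herr := sum_flip_eq (fun x v => joint (fun _ : Fin 2 => (1 / 2 : ℝ)) p (x, v)) id
    have hle : ∑ v, joint (fun _ : Fin 2 => (1 / 2 : ℝ)) p (id v + 1, v) ≤ d := by
      rw [herr]
      refine le_of_eq_of_le (sum_congr rfl fun v _ => sum_congr rfl fun x _ => ?_) hdist
      simp only [joint, id]
      ring
    have hb := binEntropy_le_of_le (sum_nonneg fun v _ => h0 _ _) hle
    rw [min_eq_left hd] at hb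
    gcongr
    exact hc.trans hb

/-! ### Wyner's common information of the doubly symmetric binary source -/

/-- The quotient is a power series in `x²` with positive coefficients. -/
theorem log_one_add_sub_log_one_sub_div_mono {x y : ℝ} (hx : 0 < x) (hxy : x ≤ y) (hy : y < 1) :
    (Real.log (1 + x) - Real.log (1 - x)) / x ≤ (Real.log (1 + y) - Real.log (1 - y)) / y := by
  have key : ∀ z : ℝ, 0 < z → z < 1 → HasSum (fun k : ℕ =>
      2 * (1 / (2 * (k : ℝ) + 1)) * z ^ (2 * k)) ((Real.log (1 + z) - Real.log (1 - z)) / z) := by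
    intro z hz hz1
    have hz' : |z| < 1 := by rwa [abs_of_pos hz]
    have hsum := (Real.hasSum_log_sub_log_of_abs_lt_one hz').div_const z
    have hterm : ∀ k : ℕ, 2 * (1 / (2 * (k : ℝ) + 1)) * z ^ (2 * k + 1) / z =
        2 * (1 / (2 * (k : ℝ) + 1)) * z ^ (2 * k) := by
      intro k
      rw [pow_succ]
      field_simp
    simpa only [hterm] using hsum
  refine hasSum_le (fun k => ?_) (key x hx (hxy.trans_lt hy)) (key y (hx.trans_le hxy) hy)
  gcongr

theorem deriv_binEntropy_half_add_sqrt {t : ℝ} (ht0 : 0 < t) (ht1 : t < 1 / 4) :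
    HasDerivAt (fun t => Real.binEntropy (1 / 2 + √t))
      (-((Real.log (1 + 2 * √t) - Real.log (1 - 2 * √t)) / (2 * √t))) t := by
  have hs0 : 0 < √t := Real.sqrt_pos.2 ht0
  have hs1 : √t < 1 / 2 := by
    rw [Real.sqrt_lt' (by norm_num)]
    linarith
  have h1 := (Real.hasDerivAt_binEntropy (p := 1 / 2 + √t) (by positivity) (by linarith)).comp t
    ((Real.hasDerivAt_sqrt ht0.ne').const_add (1 / 2))
  refine h1.congr_deriv ?_
  rw [show 1 - (1 / 2 + √t) = (1 - 2 * √t) / 2 by ring,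
    show 1 / 2 + √t = (1 + 2 * √t) / 2 by ring, Real.log_div (by linarith) two_ne_zero,
    Real.log_div (by positivity) two_ne_zero]
  ring

/-- With `t = (a - 1/2)²` as variable, entropy bounds reduce to second moments. The derivative in
`t` is minus the increasing quotient above, at `2√t`. -/
theorem concaveOn_binEntropy_half_add_sqrt :
    ConcaveOn ℝ (Set.Icc 0 (1 / 4)) fun t => Real.binEntropy (1 / 2 + √t) := by
  refine AntitoneOn.concaveOn_of_deriv (convex_Icc _ _) ?_ ?_ ?_
  · exact (by fun_prop : Continuous fun t => Real.binEntropy (1 / 2 + √t)).continuousOn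
  · rw [interior_Icc]
    intro t ht
    exact (deriv_binEntropy_half_add_sqrt ht.1 ht.2).differentiableAt.differentiableWithinAt
  · rw [interior_Icc]
    intro t ht s hs hts
    rw [(deriv_binEntropy_half_add_sqrt ht.1 ht.2).deriv,
      (deriv_binEntropy_half_add_sqrt hs.1 hs.2).deriv, neg_le_neg_iff]
    have hs1 : √s < 1 / 2 := by
      rw [Real.sqrt_lt' (by norm_num)]
      linarith [hs.2]
    exact log_one_add_sub_log_one_sub_div_mono (by have := Real.sqrt_pos.2 ht.1; positivity)
      (by gcongr) (by linarith)

theorem binEntropy_eq_half_add_sqrt (a : ℝ) :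
    Real.binEntropy a = Real.binEntropy (1 / 2 + √((a - 1 / 2) ^ 2)) := by
  rw [Real.sqrt_sq_eq_abs]
  rcases abs_cases (a - 1 / 2) with ⟨e, -⟩ | ⟨e, -⟩ <;> rw [e]
  · congr 1; ring
  · rw [← Real.binEntropy_one_sub]
    congr 1; ring

/-- The unnormalised slice at one value of `W`: conditional independence makes the entropies of `X`
and `Y` add. A slice without mass contributes zero. -/
theorem sum_negMulLog_of_markov {p : Fin 2 → Fin 2 → ℝ} (hp : ∀ x y, 0 ≤ p x y)
    (hM : ∀ x y, p x y * (∑ x, ∑ y, p x y) = (∑ y, p x y) * ∑ x, p x y) :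
    (∑ x, ∑ y, Real.negMulLog (p x y)) - Real.negMulLog (∑ x, ∑ y, p x y) =
      (∑ x, ∑ y, p x y) * (Real.binEntropy ((∑ y, p 1 y) / ∑ x, ∑ y, p x y) +
        Real.binEntropy ((∑ x, p x 1) / ∑ x, ∑ y, p x y)) := by
  obtain ⟨s, hs⟩ : ∃ s, s = ∑ x, ∑ y, p x y := ⟨_, rfl⟩
  obtain ⟨a, ha⟩ : ∃ a : Fin 2 → ℝ, a = fun x => ∑ y, p x y := ⟨_, rfl⟩
  obtain ⟨b, hb⟩ : ∃ b : Fin 2 → ℝ, b = fun y => ∑ x, p x y := ⟨_, rfl⟩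
  have ha0 : ∀ x, 0 ≤ a x := fun x => by rw [ha]; exact sum_nonneg fun y _ => hp x y
  have hb0 : ∀ x, 0 ≤ b x := fun y => by rw [hb]; exact sum_nonneg fun x _ => hp x y
  have has : a 1 + a 0 = s := by rw [hs, ha, Fin.sum_univ_two, add_comm]
  have hbs : b 1 + b 0 = s := by rw [hs, hb, sum_comm, Fin.sum_univ_two, add_comm]
  have hM' : ∀ x y, p x y * s = a x * b y := fun x y => by rw [hs, ha, hb]; exact hM x y
  rw [← hs, show (∑ y, p 1 y) = a 1 by rw [ha], show (∑ x, p x 1) = b 1 by rw [hb]]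
  have hs0 : 0 ≤ s := by rw [hs]; exact sum_nonneg fun x _ => sum_nonneg fun y _ => hp x y
  rcases hs0.eq_or_lt with h0 | h0
  · have hz : ∀ x y, p x y = 0 := by
      intro x y
      refine le_antisymm ?_ (hp x y)
      rw [h0, hs]
      exact (single_le_sum (f := p x) (fun y _ => hp x y) (mem_univ y)).trans
        (single_le_sum (f := fun x => ∑ y, p x y) (fun x _ => sum_nonneg fun y _ => hp x y)
          (mem_univ x))
    simp [hz, ← h0]
  · have e1 := negMulLog_add_sub (ha0 1) (ha0 0)
    rw [has] at e1
    have e2 : ∀ x y, Real.negMulLog (p x y) =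
        b y / s * Real.negMulLog (a x) + a x * Real.negMulLog (b y / s) := by
      intro x y
      rw [← Real.negMulLog_mul, ← mul_div_assoc, ← hM', mul_div_cancel_right₀ _ h0.ne']
    have e3 : 1 - b 1 / s = b 0 / s := by
      rw [← hbs]
      rw [← hbs] at h0
      field_simp
      ring
    rw [mul_add, ← e1, Real.binEntropy_eq_negMulLog_add_negMulLog_one_sub, e3]
    simp only [e2, Fin.sum_univ_two]
    rw [show b 0 = s - b 1 by linarith, show a 0 = s - a 1 by linarith]
    field_simp
    ring

theorem entropy_dsbs (ρ : ℝ) : entropy (dsbs ρ) = 1 + h ρ := by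
  have := log_two_pos
  rw [entropy, h, binEntropy_eq_neg]
  simp only [Fintype.sum_prod_type, Fin.sum_univ_two, dsbs, if_true, zero_ne_one, one_ne_zero,
    if_false, Real.negMulLog]
  field_simp
  linear_combination -2 * mul_log_div_two ρ - 2 * mul_log_div_two (1 - ρ)

theorem mutualInfo_of_isMarkov {ρ : ℝ} (hρ : ρ ∈ Set.Icc (0 : ℝ) (1 / 2)) {k : ℕ}
    {p : Fin 2 × Fin 2 → Fin k → ℝ} (hp : IsChannel p) (hM : IsMarkov (joint (dsbs ρ) p)) :
    mutualInfo (joint (dsbs ρ) p) = 1 + h ρ -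
      (∑ w, (∑ x, ∑ y, joint (dsbs ρ) p ((x, y), w)) *
        (Real.binEntropy ((∑ y, joint (dsbs ρ) p ((1, y), w)) /
            ∑ x, ∑ y, joint (dsbs ρ) p ((x, y), w)) +
          Real.binEntropy ((∑ x, joint (dsbs ρ) p ((x, 1), w)) /
            ∑ x, ∑ y, joint (dsbs ρ) p ((x, y), w)))) / Real.log 2 := by
  have h0 : ∀ z, 0 ≤ joint (dsbs ρ) p z := fun z =>
    mul_nonneg ((dsbs_mem_stdSimplex hρ).1 _) ((hp _).1 _)
  simp only [mutualInfo]
  rw [fstMarg_joint _ hp, entropy_dsbs, add_sub_assoc, sub_eq_add_neg _ (_ / _), ← neg_div]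
  congr 1
  rw [entropy, entropy, ← sub_div]
  congr 1
  rw [Fintype.sum_prod_type_right, ← sum_sub_distrib, ← sum_neg_distrib]
  refine sum_congr rfl fun w _ => ?_
  rw [← sum_negMulLog_of_markov (p := fun x y => joint (dsbs ρ) p ((x, y), w))
    (fun x y => h0 _) fun x y => hM x y w]
  simp only [sndMarg, Fintype.sum_prod_type]
  ring

/-- Minimising `I(X,Y;W)` means maximising `H(X|W) + H(Y|W)`. The optimum is a fair bit seen through
two independent channels of crossover `d`. For optimality, let `A` and `B` be the conditional
probabilities of `X = 1` and `Y = 1` given `W`. The source fixes the mean of `(A - 1/2)(B - 1/2)`,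
hence bounds the mean squares below, and concavity in those squares bounds the entropies above. -/
theorem wynerCI_dsbs {ρ d : ℝ} (hρ : ρ ∈ Set.Icc (0 : ℝ) (1 / 2))
    (hd : d = 1 / 2 - 1 / 2 * √(1 - 2 * ρ)) : wynerCI (dsbs ρ) = 1 + h ρ - 2 * h d := by
  have hlog := log_two_pos
  have hq := dsbs_mem_stdSimplex hρ
  obtain ⟨hρ0, hρ1⟩ := hρ
  have hc0 : 0 ≤ √(1 - 2 * ρ) := Real.sqrt_nonneg _
  have hc2 : √(1 - 2 * ρ) ^ 2 = 1 - 2 * ρ := Real.sq_sqrt (by linarith)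
  have hc1 : √(1 - 2 * ρ) ≤ 1 := Real.sqrt_le_iff.2 ⟨zero_le_one, by linarith⟩
  have hd0 : 0 ≤ d := by linarith
  have hd1 : d ≤ 1 / 2 := by linarith
  have hρd : ρ = 2 * d * (1 - d) := by rw [hd]; nlinarith
  have hρ' : 0 < 1 - ρ := by linarith
  refine IsLeast.csInf_eq ⟨?_, ?_⟩
  -- Posterior of the fair bit given its two noisy copies. For `x ≠ y` it is `1/2`, written without
  -- dividing by `ρ`, so that `ρ = 0` is covered.
  · set p : Fin 2 × Fin 2 → Fin 2 → ℝ := fun xy w =>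
      if xy.1 = xy.2 then bsc d xy.1 w ^ 2 / (1 - ρ) else 1 / 2 with hp
    have hch : IsChannel p := by
      rintro ⟨x, y⟩
      refine ⟨fun w => ?_, ?_⟩
      · simp only [hp]
        split_ifs
        · positivity
        · norm_num
      · simp only [hp]
        split_ifs with hxy
        · rw [← sum_div, div_eq_one_iff_eq hρ'.ne', hρd]
          fin_cases x <;> simp [bsc] <;> ring
        · simp
    have hj : ∀ x y w, joint (dsbs ρ) p ((x, y), w) = bsc d x w * bsc d y w / 2 := by
      intro x y w
      simp only [joint, hp, dsbs]
      by_cases hxy : x = y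
      · rw [if_pos hxy, if_pos hxy, hxy]
        field_simp
      · rw [if_neg hxy, if_neg hxy, hρd]
        fin_cases x <;> fin_cases y <;> fin_cases w <;> simp [bsc] at hxy ⊢ <;> ring
    have hM : IsMarkov (joint (dsbs ρ) p) := by
      intro x y w
      simp only [hj, Fin.sum_univ_two]
      fin_cases x <;> fin_cases y <;> fin_cases w <;> simp [bsc] <;> ring
    refine ⟨2, by norm_num, p, hch, hM, ?_⟩
    rw [mutualInfo_of_isMarkov ⟨hρ0, hρ1⟩ hch hM, h, h]
    have e0 : ∑ x : Fin 2, ∑ y : Fin 2, bsc d x 0 * bsc d y 0 / 2 = 1 / 2 := by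
      simp [bsc]; ring
    have e1 : ∑ x : Fin 2, ∑ y : Fin 2, bsc d x 1 * bsc d y 1 / 2 = 1 / 2 := by
      simp [bsc]; ring
    have e2 : (∑ y : Fin 2, bsc d 1 0 * bsc d y 0 / 2) / (1 / 2) = d := by
      simp [bsc]; ring
    have e3 : (∑ y : Fin 2, bsc d y 0 * bsc d 1 0 / 2) / (1 / 2) = d := by
      simp [bsc]; ring
    have e4 : (∑ y : Fin 2, bsc d 1 1 * bsc d y 1 / 2) / (1 / 2) = 1 - d := by
      simp [bsc]; ring
    have e5 : (∑ y : Fin 2, bsc d y 1 * bsc d 1 1 / 2) / (1 / 2) = 1 - d := by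
      simp [bsc]; ring
    simp only [hj]
    rw [Fin.sum_univ_two, e0, e1, e2, e3, e4, e5, Real.binEntropy_one_sub]
    ring
  · rintro r ⟨k, -, p, hp, hM, rfl⟩
    rw [mutualInfo_of_isMarkov ⟨hρ0, hρ1⟩ hp hM, h, h]
    have h0 : ∀ z, 0 ≤ joint (dsbs ρ) p z := fun z => mul_nonneg (hq.1 _) ((hp _).1 _)
    have hmarg : ∀ x y, ∑ w, joint (dsbs ρ) p ((x, y), w) = dsbs ρ (x, y) := fun x y =>
      congrFun (fstMarg_joint (dsbs ρ) hp) (x, y)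
    set P : Fin 2 → Fin 2 → Fin k → ℝ := fun x y w => joint (dsbs ρ) p ((x, y), w) with hP
    set s : Fin k → ℝ := fun w => ∑ x, ∑ y, P x y w with hs
    set A : Fin k → ℝ := fun w => (∑ y, P 1 y w) / s w with hA
    set B : Fin k → ℝ := fun w => (∑ x, P x 1 w) / s w with hB
    have hs0 : ∀ w, 0 ≤ s w := fun w => sum_nonneg fun x _ => sum_nonneg fun y _ => h0 _
    have hs1 : ∑ w, s w = 1 := by
      simp only [hs, Fin.sum_univ_two, sum_add_distrib, hP, hmarg, dsbs, if_true, zero_ne_one,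
        one_ne_zero, if_false]
      ring
    have hsz : ∀ w, s w = 0 → ∀ x y, P x y w = 0 := by
      intro w hw x y
      refine le_antisymm ?_ (h0 _)
      rw [← hw]
      exact (single_le_sum (f := fun y => P x y w) (fun y _ => h0 _) (mem_univ y)).trans
        (single_le_sum (f := fun x => ∑ y, P x y w) (fun x _ => sum_nonneg fun y _ => h0 _)
          (mem_univ x))
    have hsA : ∀ w, s w * A w = ∑ y, P 1 y w := by
      intro w
      by_cases hw : s w = 0
      · simp [hw, hsz w hw]
      · exact mul_div_cancel₀ _ hw
    have hsB : ∀ w, s w * B w = ∑ x, P x 1 w := by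
      intro w
      by_cases hw : s w = 0
      · simp [hw, hsz w hw]
      · exact mul_div_cancel₀ _ hw
    have hsAB : ∀ w, s w * A w * B w = P 1 1 w := by
      intro w
      by_cases hw : s w = 0
      · simp [hw, hsz w hw]
      · have hMw : P 1 1 w * s w = (∑ y, P 1 y w) * ∑ x, P x 1 w := hM 1 1 w
        rw [hsA, ← mul_right_cancel_iff_of_pos ((hs0 w).lt_of_ne' hw), hMw, ← hsB]
        ring
    have hA01 : ∀ w, A w ∈ Set.Icc (0 : ℝ) 1 := fun w =>
      ⟨div_nonneg (sum_nonneg fun y _ => h0 _) (hs0 w), div_le_one_of_le₀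
        (single_le_sum (f := fun x => ∑ y, P x y w) (fun x _ => sum_nonneg fun y _ => h0 _)
          (mem_univ 1)) (hs0 w)⟩
    have hB01 : ∀ w, B w ∈ Set.Icc (0 : ℝ) 1 := fun w =>
      ⟨div_nonneg (sum_nonneg fun y _ => h0 _) (hs0 w), div_le_one_of_le₀
        (sum_le_sum fun x _ => single_le_sum (f := fun y => P x y w) (fun y _ => h0 _)
          (mem_univ 1)) (hs0 w)⟩
    have hsq : ∀ {a : ℝ}, a ∈ Set.Icc (0 : ℝ) 1 → (a - 1 / 2) ^ 2 ∈ Set.Icc (0 : ℝ) (1 / 4) :=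
      fun {a} ha => ⟨sq_nonneg _, by nlinarith [ha.1, ha.2]⟩
    set φ : ℝ → ℝ := fun t => Real.binEntropy (1 / 2 + √t) with hφ
    have hconc : ConcaveOn ℝ (Set.Icc 0 (1 / 4)) φ := concaveOn_binEntropy_half_add_sqrt
    set τ : Fin k → ℝ := fun w => 1 / 2 * (A w - 1 / 2) ^ 2 + 1 / 2 * (B w - 1 / 2) ^ 2 with hτ
    have hτmem : ∀ w, τ w ∈ Set.Icc (0 : ℝ) (1 / 4) := fun w =>
      convex_Icc (0 : ℝ) (1 / 4) (hsq (hA01 w)) (hsq (hB01 w))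
        (show (0 : ℝ) ≤ 1 / 2 by norm_num) (show (0 : ℝ) ≤ 1 / 2 by norm_num) (by norm_num)
    have hpair : ∀ w, Real.binEntropy (A w) + Real.binEntropy (B w) ≤ 2 * φ (τ w) := by
      intro w
      have := hconc.2 (hsq (hA01 w)) (hsq (hB01 w))
        (show (0 : ℝ) ≤ 1 / 2 by norm_num) (show (0 : ℝ) ≤ 1 / 2 by norm_num) (by norm_num)
      simp only [smul_eq_mul] at this
      rw [binEntropy_eq_half_add_sqrt (A w), binEntropy_eq_half_add_sqrt (B w)]
      linarith
    have hjensen := hconc.le_map_sum (t := univ) (fun w _ => hs0 w) hs1 fun w _ => hτmem w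
    simp only [smul_eq_mul] at hjensen
    have hmem : ∑ w, s w * τ w ∈ Set.Icc (0 : ℝ) (1 / 4) :=
      (convex_Icc (0 : ℝ) (1 / 4)).sum_mem (fun w _ => hs0 w) hs1 fun w _ => hτmem w
    -- The mean of `(A - 1/2)(B - 1/2)` is `P(X = Y = 1) - 1/4 = (1 - 2ρ)/4`, and a product is at
    -- most the mean of the squares.
    have huv : (1 / 2 * √(1 - 2 * ρ)) ^ 2 ≤ ∑ w, s w * τ w := by
      have e1 : ∑ w, s w * ((A w - 1 / 2) * (B w - 1 / 2)) = (1 - 2 * ρ) / 4 := by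
        have : ∀ w, s w * ((A w - 1 / 2) * (B w - 1 / 2)) =
            P 1 1 w - 1 / 2 * (∑ y, P 1 y w) - 1 / 2 * (∑ x, P x 1 w) + 1 / 4 * s w := by
          intro w
          rw [← hsAB, ← hsA, ← hsB]
          ring
        simp only [this, sum_add_distrib, sum_sub_distrib, ← mul_sum, hs1, Fin.sum_univ_two, hP,
          hmarg, dsbs, if_true, zero_ne_one, one_ne_zero, if_false]
        ring
      rw [mul_pow, hc2, show (1 / 2 : ℝ) ^ 2 * (1 - 2 * ρ) = (1 - 2 * ρ) / 4 by ring, ← e1]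
      refine sum_le_sum fun w _ => mul_le_mul_of_nonneg_left ?_ (hs0 w)
      simp only [hτ]
      nlinarith [sq_nonneg (A w - B w)]
    have hanti : φ (∑ w, s w * τ w) ≤ Real.binEntropy d := by
      have e1 : 1 / 2 * √(1 - 2 * ρ) ≤ √(∑ w, s w * τ w) := Real.le_sqrt_of_sq_le huv
      have e2 : √(∑ w, s w * τ w) ≤ 1 / 2 := by
        rw [Real.sqrt_le_left (by norm_num)]
        linarith [hmem.2]
      have := Real.binEntropy_strictAntiOn.antitoneOn (a := 1 / 2 + 1 / 2 * √(1 - 2 * ρ))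
        (b := 1 / 2 + √(∑ w, s w * τ w)) ⟨by linarith, by linarith⟩ ⟨by linarith, by linarith⟩
        (by linarith)
      rwa [show 1 / 2 + 1 / 2 * √(1 - 2 * ρ) = 1 - d by rw [hd]; ring,
        Real.binEntropy_one_sub] at this
    have hfinal : ∑ w, s w * (Real.binEntropy (A w) + Real.binEntropy (B w)) ≤
        2 * Real.binEntropy d := by
      calc _ ≤ ∑ w, s w * (2 * φ (τ w)) :=
            sum_le_sum fun w _ => mul_le_mul_of_nonneg_left (hpair w) (hs0 w)
        _ = 2 * ∑ w, s w * φ (τ w) := by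
            rw [mul_sum]
            exact sum_congr rfl fun w _ => by ring
        _ ≤ _ := by linarith
    rw [← mul_div_assoc]
    gcongr

/-! ### The doubly symmetric binary source: the three regimes -/

theorem exists_hamming_eq_zero {α : Type} [DecidableEq α] (a : α) : ∃ b, hamming a b = 0 :=
  ⟨a, by simp [hamming]⟩

theorem fstMarg_dsbs (ρ : ℝ) : fstMarg (dsbs ρ) = fun _ => 1 / 2 := by
  funext x
  fin_cases x <;> simp [fstMarg, dsbs] <;> ring

theorem sndMarg_dsbs (ρ : ℝ) : sndMarg (dsbs ρ) = fun _ => 1 / 2 := by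
  funext x
  fin_cases x <;> simp [sndMarg, dsbs] <;> ring

theorem crFun_eq_rdFun_eq {ρ d : ℝ} (hρ : ρ ∈ Set.Icc (0 : ℝ) (1 / 2))
    (hd : d ∈ Set.Icc (0 : ℝ) (1 / 2)) (hdρ : 2 * d * (1 - d) ≤ ρ) :
    crFun (dsbs ρ) hamming hamming d d = rdFun (dsbs ρ) hamming hamming d d ∧
      rdFun (dsbs ρ) hamming hamming d d = h ρ - h d := by
  have hmem := h_sub_h_mem_crRates hρ hd hdρ
  have hrd := isLeast_rdFun (dsbs ρ) exists_hamming_eq_zero exists_hamming_eq_zero hd.1 hd.1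
  have hcr := isLeast_crFun (dsbs ρ) exists_hamming_eq_zero exists_hamming_eq_zero hd.1 hd.1
  have hsub := crRates_subset_rates (dsbs ρ) hamming hamming d d
  have h1 := h_sub_h_le_of_mem_rates hρ hd.2 hrd.1
  have h2 := hrd.2 (hsub hmem)
  have h3 := h_sub_h_le_of_mem_rates hρ hd.2 (hsub hcr.1)
  have h4 := hcr.2 hmem
  constructor <;> linarith

end TwoWayRelay

end

theorem theorem3 (ρ dstar : ℝ) (hρ : ρ ∈ Set.Icc (0 : ℝ) (1 / 2))
    (hdstar : dstar = 1 / 2 - 1 / 2 * Real.sqrt (1 - 2 * ρ)) :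
    (∀ d ∈ Set.Icc (0 : ℝ) dstar,
      TwoWayRelay.crFun (TwoWayRelay.dsbs ρ) TwoWayRelay.hamming TwoWayRelay.hamming d d =
          TwoWayRelay.rdFun (TwoWayRelay.dsbs ρ) TwoWayRelay.hamming TwoWayRelay.hamming d d ∧
        TwoWayRelay.rdFun (TwoWayRelay.dsbs ρ) TwoWayRelay.hamming TwoWayRelay.hamming d d =
          TwoWayRelay.h ρ - TwoWayRelay.h d) ∧
    (TwoWayRelay.crFun (TwoWayRelay.dsbs ρ) TwoWayRelay.hamming TwoWayRelay.hamming dstar dstar =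
        TwoWayRelay.wynerCI (TwoWayRelay.dsbs ρ) -
          TwoWayRelay.marginalRD (TwoWayRelay.fstMarg (TwoWayRelay.dsbs ρ))
            TwoWayRelay.hamming dstar ∧
      TwoWayRelay.crFun (TwoWayRelay.dsbs ρ) TwoWayRelay.hamming TwoWayRelay.hamming dstar dstar =
        TwoWayRelay.wynerCI (TwoWayRelay.dsbs ρ) -
          TwoWayRelay.marginalRD (TwoWayRelay.sndMarg (TwoWayRelay.dsbs ρ))
            TwoWayRelay.hamming dstar) ∧
    (∀ d ∈ Set.Ioc dstar (1 / 2),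
      TwoWayRelay.crFun (TwoWayRelay.dsbs ρ) TwoWayRelay.hamming TwoWayRelay.hamming d d ≠
          TwoWayRelay.h ρ - TwoWayRelay.h d ∧
        TwoWayRelay.crFun (TwoWayRelay.dsbs ρ) TwoWayRelay.hamming TwoWayRelay.hamming d d ≤
          TwoWayRelay.h d - ρ -
            (1 - ρ) * TwoWayRelay.h ((2 * d - ρ) / (2 * (1 - ρ)))) := by
  have hc0 : 0 ≤ √(1 - 2 * ρ) := Real.sqrt_nonneg _
  have hc2 : √(1 - 2 * ρ) ^ 2 = 1 - 2 * ρ := Real.sq_sqrt (by linarith [hρ.2])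
  have hc1 : √(1 - 2 * ρ) ≤ 1 := Real.sqrt_le_iff.2 ⟨zero_le_one, by linarith [hρ.1]⟩
  have hs0 : 0 ≤ dstar := by linarith
  have hs1 : dstar ≤ 1 / 2 := by linarith
  -- `dstar` is the root in `[0, 1/2]`, where `2d(1-d)` increases; this decides the regime of every
  -- `d`.
  have hρd : 2 * dstar * (1 - dstar) = ρ := by rw [hdstar]; nlinarith
  refine ⟨fun d hd => ?_, ?_, fun d hd => ⟨fun heq => ?_, ?_⟩⟩
  · exact TwoWayRelay.crFun_eq_rdFun_eq hρ ⟨hd.1, hd.2.trans hs1⟩ (by nlinarith [hd.1, hd.2])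
  · obtain ⟨h1, h2⟩ := TwoWayRelay.crFun_eq_rdFun_eq hρ ⟨hs0, hs1⟩ hρd.le
    rw [TwoWayRelay.fstMarg_dsbs, TwoWayRelay.sndMarg_dsbs,
      TwoWayRelay.marginalRD_uniform_bit hs0 hs1, TwoWayRelay.wynerCI_dsbs hρ hdstar, h1, h2]
    constructor <;> ring
  · have hd0 : 0 ≤ d := hs0.trans hd.1.le
    have hcr := (TwoWayRelay.isLeast_crFun (TwoWayRelay.dsbs ρ)
      TwoWayRelay.exists_hamming_eq_zero TwoWayRelay.exists_hamming_eq_zero hd0 hd0).1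
    -- Equality would make `h ρ - h d` itself achievable, since the infimum is attained.
    rw [heq] at hcr
    have := TwoWayRelay.le_of_h_sub_h_mem_crRates hρ hd0 hd.2 hcr
    nlinarith [hd.1, hd.2]
  · have hd0 : 0 < d := hs0.trans_lt hd.1
    exact (TwoWayRelay.isLeast_crFun (TwoWayRelay.dsbs ρ) TwoWayRelay.exists_hamming_eq_zero
      TwoWayRelay.exists_hamming_eq_zero hd0.le hd0.le).2
      (TwoWayRelay.upper_bound_mem_crRates hρ hd0 hd.2 (by nlinarith [hd.1]))
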